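/- There exist universal constants $c, c_1, c_2 > 0$ such that the following holds. Let $X^\star \in \mathbb{R}^{n_1 \times n_2}$ have rank exactly $r \ge 1$, with rank-$r$ singular value decomposition $X^\star = U^\star \Sigma^\star {V^\star}^\top$, where $U^\star \in \mathbb{R}^{n_1\times r}$ and $V^\star \in \mathbb{R}^{n_2\times r}$ have orthonormal columns and $\Sigma^\star = \mathrm{diag}(\sigma^\star_1 \ge \dots \ge \sigma^\star_r)$, $\sigma^\star_r>0$. Put $\kappa = \sigma^\star_1/\sigma^\star_r$ and $n = \max(n_1,n_2)$, and write $n_1 \wedge n_2 = \min(n_1, n_2)$. Assume that $X^\star$ is $\mu$-incoherent: every row of $U^\star$ has Euclidean norm at most $\sqrt{\mu r/n_1}$ and every row of $V^\star$ has Euclidean norm at most $\sqrt{\mu r/n_2}$. Let $Z^\star = \begin{bmatrix} U^\star \\ V^\star \end{bmatrix} {\Sigma^\star}^{1/2} \in \mathbb{R}^{(n_1+n_2)\times r}$, and for $Z \in \mathbb{R}^{(n_1+n_2)\times r}$ let $$ d(Z, Z^\star) = \min_{R \in \mathbb{R}^{r\times r},\; R R^\top = R^\top R = I} \| Z - Z^\star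 R \|_F. $$ Let $0 < p \le 1$ and let $\Omega$ be a random subset of $\{1,\dots,n_1\}\times\{1,\dots,n_2\}$ that contains each index pair independently with probability $p$. Let $\mathcal{P}_\Omega(X^\star)$ be the matrix that agrees with $X^\star$ on $\Omega$ and is zero elsewhere. Let $U^0 \Sigma^0 {V^0}^\top$ be a rank-$r$ (truncated) singular value decomposition of $p^{-1}\mathcal{P}_\Omega(X^\star)$, i.e. its first $r$ singular triples, let $$ Z^0 = \begin{bmatrix} U^0 \\ V^0 \end{bmatrix} (\Sigma^0)^{1/2}, $$ and let $Z^1$ be obtained from $Z^0$ by row-wise clipping at the radius $\rho = \sqrt{\frac{2\mu r}{n_1\wedge n_2}}\,\|Z^0\|$, where $\|\cdot\|$ is the operator norm: a row of Euclidean norm at most $\rho$ is kept, and any other row is rescaled to have norm $\rho$. If $$ p \ge \frac{c\, \mu r^2 \kappa^2 \log n}{n_1 \wedge n_2}, $$ then with probability at least $1 - c_1 n^{-c_2}$, for every choice of the truncated singular value decomposition, $$ d(Z^1, Z^\star) \le d(Z^0, Z^\star) \le \tfrac14 \sqrt{\sigma^\star_r}. $$ -/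

import Mathlib

open MeasureTheory ProbabilityTheory

namespace MatrixCompletion

/-- Frobenius norm of a real matrix. -/
noncomputable def frobNorm {m n : Type*} [Fintype m] [Fintype n] (A : Matrix m n ℝ) : ℝ :=
  Real.sqrt (∑ i, ∑ j, A i j ^ 2)

/-- Operator (spectral) norm of a real matrix, i.e. the norm of `x ↦ A x` between Euclidean
spaces. -/
noncomputable def opNorm {m n : Type*} [Fintype m] [Fintype n] [DecidableEq n]
    (A : Matrix m n ℝ) : ℝ :=
  ‖LinearMap.toContinuousLinearMap (Matrix.toEuclideanLin A)‖

/-- Euclidean norm of the `i`-th row. -/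
noncomputable def rowNorm {m n : Type*} [Fintype n] (A : Matrix m n ℝ) (i : m) : ℝ :=
  Real.sqrt (∑ j, A i j ^ 2)

/-- `A = U Σ Vᵀ` with `U`, `V` having orthonormal columns and
`Σ = diag(σ₀ ≥ σ₁ ≥ … ≥ σ_{k-1} ≥ 0)`. -/
structure IsSVD {n₁ n₂ k : ℕ} (A : Matrix (Fin n₁) (Fin n₂) ℝ) (U : Matrix (Fin n₁) (Fin k) ℝ)
    (σ : Fin k → ℝ) (V : Matrix (Fin n₂) (Fin k) ℝ) : Prop where
  orthonormal_left : U.transpose * U = 1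
  orthonormal_right : V.transpose * V = 1
  antitone : Antitone σ
  nonneg : ∀ i, 0 ≤ σ i
  eq_mul : A = U * Matrix.diagonal σ * V.transpose

/-- `U Σ Vᵀ` is a rank-`r` (truncated) SVD of `A`: it consists of the first `r` singular triples
of some SVD of `A` (with all `min n₁ n₂` singular values, zeros included). -/
def IsTruncatedSVD {n₁ n₂ r : ℕ} (A : Matrix (Fin n₁) (Fin n₂) ℝ) (U : Matrix (Fin n₁) (Fin r) ℝ)
    (σ : Fin r → ℝ) (V : Matrix (Fin n₂) (Fin r) ℝ) : Prop :=
  ∃ (U' : Matrix (Fin n₁) (Fin (min n₁ n₂)) ℝ) (σ' : Fin (min n₁ n₂) → ℝ)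
    (V' : Matrix (Fin n₂) (Fin (min n₁ n₂)) ℝ) (h : r ≤ min n₁ n₂),
    IsSVD A U' σ' V' ∧
    (∀ i j, U i j = U' i (Fin.castLE h j)) ∧
    (∀ j, σ j = σ' (Fin.castLE h j)) ∧
    (∀ i j, V i j = V' i (Fin.castLE h j))

/-- `μ`-incoherence: `‖U‖_{2,∞} ≤ √(μ r / n₁)` and `‖V‖_{2,∞} ≤ √(μ r / n₂)`, where `‖·‖_{2,∞}` is
the largest Euclidean norm of a row. -/
def IsIncoherent {n₁ n₂ r : ℕ} (μ : ℝ) (U : Matrix (Fin n₁) (Fin r) ℝ)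
    (V : Matrix (Fin n₂) (Fin r) ℝ) : Prop :=
  (∀ i, rowNorm U i ≤ Real.sqrt (μ * r / n₁)) ∧ (∀ j, rowNorm V j ≤ Real.sqrt (μ * r / n₂))

/-- The lifted factor `[U; V] Σ^{1/2}`, an `(n₁ + n₂) × r` matrix. -/
noncomputable def liftedFactor {n₁ n₂ r : ℕ} (U : Matrix (Fin n₁) (Fin r) ℝ) (σ : Fin r → ℝ)
    (V : Matrix (Fin n₂) (Fin r) ℝ) : Matrix (Fin n₁ ⊕ Fin n₂) (Fin r) ℝ :=
  Matrix.fromRows U V * Matrix.diagonal (fun j => Real.sqrt (σ j))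

open Classical in
/-- The sampling projection `P_Ω`. -/
noncomputable def sampleProj {n₁ n₂ : ℕ} (Ω : Set (Fin n₁ × Fin n₂))
    (X : Matrix (Fin n₁) (Fin n₂) ℝ) : Matrix (Fin n₁) (Fin n₂) ℝ :=
  Matrix.of fun i j => if (i, j) ∈ Ω then X i j else 0

/-- `d(Z, Z⋆) = min_{R Rᵀ = Rᵀ R = 1} ‖Z - Z⋆ R‖_F` (the orthogonal group is compact and nonempty,
so the infimum is a minimum). -/
noncomputable def factorDist {m : Type*} [Fintype m] {r : ℕ} (Z Zs : Matrix m (Fin r) ℝ) : ℝ :=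
  ⨅ R : Matrix.orthogonalGroup (Fin r) ℝ, frobNorm (Z - Zs * (R : Matrix (Fin r) (Fin r) ℝ))

/-- Row-wise clipping at radius `ρ`: rows of norm at most `ρ` are kept, the other ones are rescaled
to norm `ρ`. -/
noncomputable def clipRows {m : Type*} {r : ℕ} (ρ : ℝ) (Z : Matrix m (Fin r) ℝ) :
    Matrix m (Fin r) ℝ :=
  Matrix.of fun i j => if rowNorm Z i ≤ ρ then Z i j else Z i j / rowNorm Z i * ρ

/-- The clipping radius `√(2 μ r / (n₁ ∧ n₂)) ‖Z⁰‖`. -/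
noncomputable def clipRadius {n₁ n₂ r : ℕ} (μ : ℝ) (Z₀ : Matrix (Fin n₁ ⊕ Fin n₂) (Fin r) ℝ) : ℝ :=
  Real.sqrt (2 * μ * r / (min n₁ n₂ : ℕ)) * opNorm Z₀

end MatrixCompletion
namespace MatrixCompletion
open Module InnerProductSpace in
/-- Every real matrix has an SVD. -/
theorem exists_isSVD {n₁ n₂ : ℕ} (A : Matrix (Fin n₁) (Fin n₂) ℝ) :
    ∃ (U : Matrix (Fin n₁) (Fin (min n₁ n₂)) ℝ) (σ : Fin (min n₁ n₂) → ℝ)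
      (V : Matrix (Fin n₂) (Fin (min n₁ n₂)) ℝ), IsSVD A U σ V := by
  classical
  set T : EuclideanSpace ℝ (Fin n₂) →ₗ[ℝ] EuclideanSpace ℝ (Fin n₁) := Matrix.toEuclideanLin A
    with hT
  have hn : finrank ℝ (EuclideanSpace ℝ (Fin n₂)) = n₂ := by simp
  set e := T.isSymmetric_adjoint_comp_self.eigenvectorBasis hn with he
  set s : ℕ → ℝ := fun j => T.singularValues j with hs
  have hinner : ∀ i j : Fin n₂, ⟪T (e i), T (e j)⟫_ℝ = if i = j then s j ^ 2 else 0 := by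
    intro i j
    have h1 : (LinearMap.adjoint T ∘ₗ T) (e j) = (s j ^ 2) • e j := by
      rw [he, T.isSymmetric_adjoint_comp_self.apply_eigenvectorBasis hn j, hs]
      simp only [T.sq_singularValues_fin hn j]
      rfl
    rw [← LinearMap.adjoint_inner_right, ← LinearMap.comp_apply, h1, inner_smul_right,
      orthonormal_iff_ite.mp e.orthonormal i j]
    split_ifs <;> simp
  have hs2 : ∀ j, s j ≠ 0 → j < n₂ := by
    intro j hj
    by_contra h
    exact hj (T.singularValues_of_finrank_le (by rw [hn]; omega))
  have hs1 : ∀ j, s j ≠ 0 → j < n₁ := by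
    intro j hj
    have h1 : j ∈ T.singularValues.support := Finsupp.mem_support_iff.mpr hj
    rw [T.support_singularValues, Finset.mem_range] at h1
    have h2 : finrank ℝ T.range ≤ finrank ℝ (EuclideanSpace ℝ (Fin n₁)) := Submodule.finrank_le _
    simp only [finrank_euclideanSpace, Fintype.card_fin] at h2
    omega
  have hs_anti : ∀ i j, i ≤ j → s j ≤ s i := fun i j hij => T.singularValues_antitone hij
  have hs_nonneg : ∀ i, 0 ≤ s i := fun i => T.singularValues_nonneg i
  clear_value e s
  clear he hs
  let w : Fin n₁ → EuclideanSpace ℝ (Fin n₁) := fun j =>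
    if h : (j : ℕ) < n₂ then (s j)⁻¹ • T (e ⟨j, h⟩) else 0
  let S : Set (Fin n₁) := {j | s j ≠ 0}
  have hw : Orthonormal ℝ (S.domRestrict w) := by
    rw [orthonormal_iff_ite]
    rintro ⟨i, hi⟩ ⟨j, hj⟩
    have hi' : s i ≠ 0 := hi
    have hj' : s j ≠ 0 := hj
    have e1 : w i = (s i)⁻¹ • T (e ⟨i, hs2 _ hi⟩) := dif_pos _
    have e2 : w j = (s j)⁻¹ • T (e ⟨j, hs2 _ hj⟩) := dif_pos _
    change ⟪w i, w j⟫_ℝ = _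
    rw [e1, e2, inner_smul_left, inner_smul_right, hinner]
    by_cases hij : i = j
    · subst hij
      simp
      field_simp
    · have : (i : ℕ) ≠ j := fun h => hij (Fin.ext h)
      simp [hij, this]
  obtain ⟨b, hb⟩ := Orthonormal.exists_orthonormalBasis_extension_of_card_eq
    (𝕜 := ℝ) (by simp) hw
  have hTe1 : ∀ (j : ℕ) (h1 : j < n₁) (h2 : j < n₂), T (e ⟨j, h2⟩) = s j • b ⟨j, h1⟩ := by
    intro j h1 h2
    by_cases hj : s j = 0
    · have := hinner ⟨j, h2⟩ ⟨j, h2⟩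
      simp only [hj, if_true] at this
      rw [hj, zero_smul]
      simpa using this
    · rw [hb ⟨j, h1⟩ hj]
      have e1 : w ⟨j, h1⟩ = (s j)⁻¹ • T (e ⟨j, h2⟩) := dif_pos _
      rw [e1, smul_smul, mul_inv_cancel₀ hj, one_smul]
  have hTe2 : ∀ (j : ℕ) (_ : ¬ j < n₁) (h2 : j < n₂), T (e ⟨j, h2⟩) = 0 := by
    intro j h1 h2
    have hj : s j = 0 := by
      by_contra h
      exact h1 (hs1 j h)
    have := hinner ⟨j, h2⟩ ⟨j, h2⟩
    simp only [hj, if_true] at this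
    simpa using this
  refine ⟨Matrix.of fun i j => b (Fin.castLE (min_le_left _ _) j) i, fun j => s j,
    Matrix.of fun i j => e (Fin.castLE (min_le_right _ _) j) i, ?_, ?_, ?_, ?_, ?_⟩
  · ext i j
    have := orthonormal_iff_ite.mp b.orthonormal (Fin.castLE (min_le_left _ _) i)
      (Fin.castLE (min_le_left n₁ n₂) j)
    simp only [PiLp.inner_apply, Fin.castLE_inj] at this
    rw [Matrix.mul_apply, Matrix.one_apply, ← this]
    exact Finset.sum_congr rfl fun x _ => mul_comm _ _
  · ext i j
    have := orthonormal_iff_ite.mp e.orthonormal (Fin.castLE (min_le_right _ _) i)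
      (Fin.castLE (min_le_right n₁ n₂) j)
    simp only [PiLp.inner_apply, Fin.castLE_inj] at this
    rw [Matrix.mul_apply, Matrix.one_apply, ← this]
    exact Finset.sum_congr rfl fun x _ => mul_comm _ _
  · exact fun i j hij => hs_anti _ _ hij
  · exact fun i => hs_nonneg i
  · ext i l
    have h1 : A i l = (T (EuclideanSpace.single l 1)) i := by
      simp [hT]
    have h2 : T (EuclideanSpace.single l 1) = ∑ j, e j l • T (e j) := by
      conv_lhs => rw [← e.sum_repr (EuclideanSpace.single l 1)]
      simp [map_sum, OrthonormalBasis.repr_apply_apply, EuclideanSpace.inner_single_right]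
    rw [h1, h2]
    have h3 : ∑ j, e j l • T (e j) = ∑ j : Fin (min n₁ n₂),
        e (Fin.castLE (min_le_right _ _) j) l • T (e (Fin.castLE (min_le_right _ _) j)) := by
      symm
      refine Finset.sum_of_injOn (Fin.castLE (min_le_right _ _))
        (Fin.castLE_injective _).injOn (by simp) ?_ (by simp)
      intro j _ hj
      rw [hTe2 j _ j.2, smul_zero]
      intro h
      exact hj ⟨⟨j, lt_min h j.2⟩, by simp, rfl⟩
    rw [h3, Matrix.mul_apply]
    simp only [Matrix.mul_diagonal, Matrix.transpose_apply, Matrix.of_apply]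
    rw [WithLp.ofLp_sum, Finset.sum_apply]
    refine Finset.sum_congr rfl fun j _ => ?_
    have := hTe1 j (lt_of_lt_of_le j.2 (min_le_left _ _)) (lt_of_lt_of_le j.2 (min_le_right _ _))
    have h4 : T (e (Fin.castLE (min_le_right _ _) j))
      = s j • b (Fin.castLE (min_le_left _ _) j) := this
    rw [h4]
    simp
    ring

/-- A rank-`r` truncated SVD exists whenever `r ≤ min n₁ n₂`. -/
theorem exists_isTruncatedSVD {n₁ n₂ r : ℕ} (h : r ≤ min n₁ n₂) (A : Matrix (Fin n₁) (Fin n₂) ℝ) :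
    ∃ (U : Matrix (Fin n₁) (Fin r) ℝ) (σ : Fin r → ℝ) (V : Matrix (Fin n₂) (Fin r) ℝ),
      IsTruncatedSVD A U σ V := by
  obtain ⟨U, σ, V, hA⟩ := exists_isSVD A
  exact ⟨Matrix.of fun i j => U i (Fin.castLE h j), fun j => σ (Fin.castLE h j),
    Matrix.of fun i j => V i (Fin.castLE h j), U, σ, V, h, hA, fun _ _ => rfl, fun _ => rfl,
    fun _ _ => rfl⟩
end MatrixCompletion

namespace MatrixCompletion

/-! Chance and linear algebra meet in a single event: the perturbation `W = p⁻¹ P_Ω(X) - X` has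
operator norm at most `s = σ_r / (20 √r)`.

Probability. The symmetric dilation of `W` is a sum of independent centred two-valued matrices, one
per entry. The Golden–Thompson inequality (`trace_exp_add_le`) allows the summands to be averaged
one at a time. Subtracting from each a compensator equal to twice its variance makes every averaging
step non-increasing, so the trace of the exponential of the compensated sum has mean at most `n₁ +
n₂`. Where the event fails, some Rayleigh quotient makes that trace large, and Markov's inequality
gives `setBernoulli_real_not_le`. Incoherence bounds the entries of `X` by `σ_1 μ r / (n₁ ∧ n₂)` and
its squared row and column norms by `σ_1² μ r / (n₁ ∧ n₂)`; with the hypothesis on `p` this yields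
failure probability at most `2 / n`.

Linear algebra. On the event, Weyl's inequality puts the rank-`r` truncation `X₀` within `2 s` of
`X` in operator norm. Since `X₀ - X` has rank at most `2 r`, its squared Frobenius norm is at most
`8 r s²`. Both lifted factors are balanced (their two blocks have equal Gram matrices), so `Z⁰ Z⁰ᵀ -
Z⋆ Z⋆ᵀ` has squared Frobenius norm at most four times that (`trace_gram_sub_sq_le`). The Procrustes
bound `exists_orthogonal_sum_sq_sub_le`, with `2 σ_r` as the least squared singular value of `Z⋆`,
converts this into `d(Z⁰, Z⋆)² ≤ σ_r / 20`.

Clipping projects each row onto a ball, which brings it no farther from any point of the ball.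
Closeness of `Z⁰` to `Z⋆ R` forces `‖Z⁰‖² ≥ σ_1 / 2`, exactly enough for the ball to contain the
rows of every rotation of `Z⋆`. -/

theorem trace_mul_transpose_self_nonneg {n m : Type*} [Fintype n] [Fintype m] (M : Matrix n m ℝ) :
    0 ≤ (M * M.transpose).trace := by
  simp only [Matrix.trace, Matrix.diag, Matrix.mul_apply, Matrix.transpose_apply]
  exact Finset.sum_nonneg fun i _ => Finset.sum_nonneg fun j _ => mul_self_nonneg _

/-! ### The Golden–Thompson inequality, via traces of dyadic powers and the Lie product formula. -/

section GoldenThompson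

variable {n : Type*} [Fintype n] [DecidableEq n]

theorem trace_mul_pow_comm (X Y : Matrix n n ℝ) (m : ℕ) :
    ((X * Y) ^ m).trace = ((Y * X) ^ m).trace := by
  cases m with
  | zero => simp
  | succ m =>
    have h : SemiconjBy X (Y * X) (X * Y) := by
      simp [SemiconjBy, Matrix.mul_assoc]
    rw [pow_succ, ← Matrix.mul_assoc, ← (h.pow_right m).eq, Matrix.mul_assoc,
      Matrix.trace_mul_comm, Matrix.mul_assoc, ← pow_succ]

theorem trace_sq_le (M : Matrix n n ℝ) : (M ^ 2).trace ≤ (M * M.transpose).trace := by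
  have h := trace_mul_transpose_self_nonneg (M - M.transpose)
  have h1 : (M.transpose * M.transpose).trace = (M * M).trace := by
    rw [← Matrix.transpose_mul, Matrix.trace_transpose]
  have h2 := Matrix.trace_mul_comm M M.transpose
  simp only [Matrix.transpose_sub, Matrix.transpose_transpose, sub_mul, mul_sub,
    Matrix.trace_sub] at h
  rw [pow_two]
  linarith

theorem two_mul_trace_mul_le {P Q : Matrix n n ℝ} (hP : P.IsSymm) (hQ : Q.IsSymm) :
    2 * (P * Q).trace ≤ (P ^ 2).trace + (Q ^ 2).trace := by
  have h := trace_mul_transpose_self_nonneg (P - Q)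
  have h2 := Matrix.trace_mul_comm P Q
  simp only [Matrix.transpose_sub, hP.eq, hQ.eq, sub_mul, mul_sub, Matrix.trace_sub] at h
  simp only [pow_two]
  linarith

/-- The two claims feed each other. The first at `k + 1` is the second at `k` for `M = P Q`,
rearranged cyclically, followed by the first for `P²` and `Q²`. The second at `k + 1` is the second
at `k` for `M²`, then the first for the Gram matrices `M Mᵀ` and `Mᵀ M`, then the
arithmetic–geometric mean inequality for traces; both Gram matrices have the same traces of powers.
-/
theorem trace_pow_two_pow_le (k : ℕ) :
    (∀ P Q : Matrix n n ℝ, P.IsSymm → Q.IsSymm →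
      ((P * Q) ^ 2 ^ k).trace ≤ (P ^ 2 ^ k * Q ^ 2 ^ k).trace) ∧
    (∀ M : Matrix n n ℝ, (M ^ 2 ^ (k + 1)).trace ≤ ((M * M.transpose) ^ 2 ^ k).trace) := by
  induction k with
  | zero => exact ⟨fun P Q _ _ => by simp, fun M => by simpa using trace_sq_le M⟩
  | succ k ih =>
    obtain ⟨hA, hB⟩ := ih
    refine ⟨fun P Q hP hQ => ?_, fun M => ?_⟩
    · have h2 : (P * Q * (P * Q).transpose) = P * (Q * Q * P) := by
        rw [Matrix.transpose_mul, hP.eq, hQ.eq]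
        simp only [Matrix.mul_assoc]
      calc ((P * Q) ^ 2 ^ (k + 1)).trace ≤ _ := hB _
        _ = ((Q ^ 2 * P ^ 2) ^ 2 ^ k).trace := by
          rw [h2, trace_mul_pow_comm]
          simp only [pow_two, Matrix.mul_assoc]
        _ = ((P ^ 2 * Q ^ 2) ^ 2 ^ k).trace := trace_mul_pow_comm _ _ _
        _ ≤ _ := hA _ _ (hP.pow 2) (hQ.pow 2)
        _ = _ := by rw [← pow_mul, ← pow_mul, ← pow_succ']
    · have hP : (M.transpose * M).IsSymm := Matrix.isSymm_transpose_mul_self M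
      have hQ : (M * M.transpose).IsSymm := Matrix.isSymm_mul_transpose_self M
      calc (M ^ 2 ^ (k + 1 + 1)).trace = ((M ^ 2) ^ 2 ^ (k + 1)).trace := by
            rw [← pow_mul, ← pow_succ']
        _ ≤ _ := hB _
        _ = ((M * (M * M.transpose * M.transpose)) ^ 2 ^ k).trace := by
          simp only [pow_two, Matrix.transpose_mul, Matrix.mul_assoc]
        _ = ((M * M.transpose * (M.transpose * M)) ^ 2 ^ k).trace := by
          rw [trace_mul_pow_comm]
          simp only [Matrix.mul_assoc]
        _ ≤ _ := hA _ _ hQ hP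
        _ ≤ _ := by
          have h := two_mul_trace_mul_le (hQ.pow (2 ^ k)) (hP.pow (2 ^ k))
          rw [← pow_mul, ← pow_mul, ← pow_succ, trace_mul_pow_comm M.transpose M] at h
          linarith

open NormedSpace in
theorem norm_exp_le_exp_norm {𝔸 : Type*} [NormedRing 𝔸] [NormOneClass 𝔸] [NormedAlgebra ℝ 𝔸]
    [CompleteSpace 𝔸] (x : 𝔸) : ‖exp x‖ ≤ Real.exp ‖x‖ := by
  have h1 := NormedSpace.exp_series_hasSum_exp' (𝕂 := ℝ) x
  have h2 := NormedSpace.exp_series_hasSum_exp' (𝕂 := ℝ) ‖x‖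
  rw [← Real.exp_eq_exp_ℝ] at h2
  refine h1.tsum_eq ▸ tsum_of_norm_bounded h2 fun i => ?_
  rw [norm_smul, smul_eq_mul, norm_inv, RCLike.norm_natCast]
  gcongr
  exact norm_pow_le _ _

theorem norm_pow_sub_pow_le {𝔸 : Type*} [NormedRing 𝔸] [NormOneClass 𝔸] {X Y : 𝔸} {M : ℝ}
    (hX : ‖X‖ ≤ M) (hY : ‖Y‖ ≤ M) (m : ℕ) :
    ‖X ^ (m + 1) - Y ^ (m + 1)‖ ≤ (m + 1) * M ^ m * ‖X - Y‖ := by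
  have hM : 0 ≤ M := (norm_nonneg _).trans hX
  induction m with
  | zero => simp
  | succ m ih =>
    have h : X ^ (m + 1 + 1) - Y ^ (m + 1 + 1)
        = X ^ (m + 1) * (X - Y) + (X ^ (m + 1) - Y ^ (m + 1)) * Y := by
      rw [pow_succ X (m + 1), pow_succ Y (m + 1)]
      noncomm_ring
    have hXm : ‖X ^ (m + 1)‖ ≤ M ^ (m + 1) := (norm_pow_le _ _).trans (by gcongr)
    rw [h]
    calc _ ≤ ‖X ^ (m + 1)‖ * ‖X - Y‖ + ‖X ^ (m + 1) - Y ^ (m + 1)‖ * ‖Y‖ :=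
          (norm_add_le _ _).trans (add_le_add (norm_mul_le _ _) (norm_mul_le _ _))
      _ ≤ M ^ (m + 1) * ‖X - Y‖ + ((m + 1) * M ^ m * ‖X - Y‖) * M := by gcongr
      _ = _ := by push_cast; ring

open NormedSpace Filter Topology in
/-- The **Lie product formula**. -/
theorem tendsto_exp_mul_exp_pow {𝔸 : Type*} [NormedRing 𝔸] [NormOneClass 𝔸] [NormedAlgebra ℝ 𝔸]
    [CompleteSpace 𝔸] (A B : 𝔸) :
    Tendsto (fun m : ℕ => (exp (((m : ℝ) + 1)⁻¹ • A) * exp (((m : ℝ) + 1)⁻¹ • B)) ^ (m + 1)) atTop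
      (𝓝 (exp (A + B))) := by
  let _ : NormedAlgebra ℚ 𝔸 := NormedAlgebra.restrictScalars ℚ ℝ 𝔸
  -- One factor errs by `F t = o(t)`. At `t = 1 / (m + 1)`, telescoping the `(m + 1)`-th powers
  -- costs a factor `m + 1` and a bounded constant, so the total error still tends to zero.
  set F : ℝ → 𝔸 := fun t => exp (t • A) * exp (t • B) - exp (t • (A + B)) with hF
  have hd : HasDerivAt F 0 0 := by
    have h1 := hasDerivAt_exp_smul_const (𝕂 := ℝ) A (0 : ℝ)
    have h2 := hasDerivAt_exp_smul_const (𝕂 := ℝ) B (0 : ℝ)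
    have h3 := hasDerivAt_exp_smul_const (𝕂 := ℝ) (A + B) (0 : ℝ)
    have h := ((h1.mul h2).sub h3).congr_deriv (g' := 0) (by simp)
    exact h
  have ho : (fun t => F t) =o[𝓝 0] fun t : ℝ => t := by
    simpa [hF] using hd.isLittleO
  have ht : Tendsto (fun m : ℕ => ((m : ℝ) + 1)⁻¹) atTop (𝓝 0) := by
    simpa using tendsto_one_div_add_atTop_nhds_zero_nat (𝕜 := ℝ)
  have ho' := ho.comp_tendsto ht
  rw [tendsto_iff_norm_sub_tendsto_zero]
  set C := Real.exp (‖A‖ + ‖B‖)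
  have hlim : Tendsto (fun m : ℕ => C * (((m : ℝ) + 1) * ‖F ((m : ℝ) + 1)⁻¹‖)) atTop (𝓝 0) := by
    have := (ho'.norm_left.tendsto_div_nhds_zero).const_mul C
    simpa [Function.comp_def, div_eq_mul_inv, mul_comm, mul_left_comm] using this
  refine squeeze_zero (fun _ => norm_nonneg _) (fun m => ?_) hlim
  set t : ℝ := ((m : ℝ) + 1)⁻¹ with htm
  have ht0 : 0 < t := by positivity
  have hmt : ((m : ℝ) + 1) * t = 1 := by rw [htm]; field_simp
  have hAB : exp (A + B) = exp (t • (A + B)) ^ (m + 1) := by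
    rw [← exp_nsmul, ← Nat.cast_smul_eq_nsmul ℝ, smul_smul]
    push_cast
    rw [hmt, one_smul]
  have hX : ‖exp (t • A) * exp (t • B)‖ ≤ Real.exp (t * (‖A‖ + ‖B‖)) := by
    refine (norm_mul_le _ _).trans ?_
    rw [mul_add, Real.exp_add]
    have hnA : t * ‖A‖ = ‖t • A‖ := by rw [norm_smul, Real.norm_of_nonneg ht0.le]
    have hnB : t * ‖B‖ = ‖t • B‖ := by rw [norm_smul, Real.norm_of_nonneg ht0.le]
    rw [hnA, hnB]
    exact mul_le_mul (norm_exp_le_exp_norm _) (norm_exp_le_exp_norm _) (norm_nonneg _)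
      (Real.exp_nonneg _)
  have hY : ‖exp (t • (A + B))‖ ≤ Real.exp (t * (‖A‖ + ‖B‖)) := by
    refine (norm_exp_le_exp_norm _).trans (Real.exp_le_exp.2 ?_)
    rw [norm_smul, Real.norm_of_nonneg ht0.le]
    gcongr
    exact norm_add_le _ _
  rw [hAB]
  refine (norm_pow_sub_pow_le hX hY m).trans ?_
  have hC : Real.exp (t * (‖A‖ + ‖B‖)) ^ m ≤ C := by
    rw [← Real.exp_nat_mul]
    refine Real.exp_le_exp.2 ?_
    have h0 : 0 ≤ ‖A‖ + ‖B‖ := by positivity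
    have : (m : ℝ) * t ≤ 1 := by nlinarith
    calc (m : ℝ) * (t * (‖A‖ + ‖B‖)) = (m * t) * (‖A‖ + ‖B‖) := by ring
      _ ≤ 1 * (‖A‖ + ‖B‖) := by gcongr
      _ = _ := one_mul _
  calc ((m : ℝ) + 1) * Real.exp (t * (‖A‖ + ‖B‖)) ^ m * ‖F t‖
      ≤ ((m : ℝ) + 1) * C * ‖F t‖ := by gcongr
    _ = _ := by ring

open NormedSpace Filter Topology in
/-- The **Golden–Thompson inequality** for real symmetric matrices. -/
theorem trace_exp_add_le [Nonempty n] {A B : Matrix n n ℝ} (hA : A.IsSymm) (hB : B.IsSymm) :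
    (exp (A + B)).trace ≤ (exp A * exp B).trace := by
  open scoped Matrix.Norms.L2Operator in
  have : NormOneClass (Matrix n n ℝ) := ⟨by
    rw [← Matrix.diagonal_one, Matrix.l2_opNorm_diagonal]; simp⟩
  let _ : NormedAlgebra ℚ (Matrix n n ℝ) := NormedAlgebra.restrictScalars ℚ ℝ _
  have hlim := tendsto_exp_mul_exp_pow A B
  -- The trace inequality is available for dyadic exponents only, so the limit is taken along `m + 1
  -- = 2 ^ k`.
  have hsub : Tendsto (fun k : ℕ => 2 ^ k - 1) atTop atTop :=
    tendsto_sub_atTop_nat 1 |>.comp (tendsto_pow_atTop_atTop_of_one_lt one_lt_two)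
  have hlim2 := (hlim.comp hsub)
  have htr : Continuous (Matrix.trace : Matrix n n ℝ → ℝ) := continuous_id.matrix_trace
  refine le_of_tendsto ((htr.tendsto _).comp hlim2) (Eventually.of_forall fun k => ?_)
  have h1 : 2 ^ k - 1 + 1 = 2 ^ k := Nat.sub_add_cancel Nat.one_le_two_pow
  have h2 : ((2 ^ k - 1 : ℕ) : ℝ) + 1 = 2 ^ k := by exact_mod_cast h1
  simp only [Function.comp_apply, h1, h2]
  refine ((trace_pow_two_pow_le k).1 _ _ (hA.smul _).exp (hB.smul _).exp).trans_eq ?_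
  rw [← exp_nsmul, ← exp_nsmul, ← Nat.cast_smul_eq_nsmul ℝ, ← Nat.cast_smul_eq_nsmul ℝ, smul_smul,
    smul_smul]
  push_cast
  rw [mul_inv_cancel₀ (by positivity), one_smul, one_smul]

end GoldenThompson

theorem dotProduct_self_nonneg {n : Type*} [Fintype n] (x : n → ℝ) : 0 ≤ x ⬝ᵥ x :=
  Finset.sum_nonneg fun _ _ => mul_self_nonneg _

/-! ### Trace exponentials of symmetric matrices and the averaging step. -/

section TraceExp

variable {n : Type*} [Fintype n] [DecidableEq n]

theorem exists_orthogonal_diagonalization {B : Matrix n n ℝ} (hB : B.IsSymm) :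
    ∃ (Q : Matrix n n ℝ) (l : n → ℝ), Q * Q.transpose = 1 ∧ Q.transpose * Q = 1 ∧
      B = Q * Matrix.diagonal l * Q.transpose ∧
      NormedSpace.exp B = Q * Matrix.diagonal (fun i => Real.exp (l i)) * Q.transpose := by
  have hH : B.IsHermitian := by
    rw [Matrix.IsHermitian, Matrix.conjTranspose_eq_transpose_of_trivial, hB.eq]
  set Q : Matrix n n ℝ := hH.eigenvectorUnitary.1 with hQ
  have h1 : Q * Q.transpose = 1 := by
    have := Unitary.mul_star_self_of_mem hH.eigenvectorUnitary.2
    rwa [Matrix.star_eq_conjTranspose, Matrix.conjTranspose_eq_transpose_of_trivial] at this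
  have h2 : Q.transpose * Q = 1 := mul_eq_one_comm.1 h1
  have h3 : B = Q * Matrix.diagonal hH.eigenvalues * Q.transpose := by
    have := hH.spectral_theorem
    rw [Unitary.conjStarAlgAut_apply, Matrix.star_eq_conjTranspose,
      Matrix.conjTranspose_eq_transpose_of_trivial] at this
    exact this
  refine ⟨Q, hH.eigenvalues, h1, h2, h3, ?_⟩
  have hinv : Q⁻¹ = Q.transpose := Matrix.inv_eq_right_inv h1
  have hu : IsUnit Q := IsUnit.of_mul_eq_one _ h1
  conv_lhs => rw [h3, ← hinv, Matrix.exp_conj _ _ hu, Matrix.exp_diagonal, hinv]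
  congr 3
  funext i
  rw [Pi.coe_exp, Real.exp_eq_exp_ℝ]

theorem dotProduct_conj_diagonal_mulVec (Q : Matrix n n ℝ) (l x : n → ℝ) :
    x ⬝ᵥ ((Q * Matrix.diagonal l * Q.transpose).mulVec x)
      = ∑ i, l i * (Q.transpose.mulVec x i) ^ 2 := by
  rw [← Matrix.mulVec_mulVec, ← Matrix.mulVec_mulVec, Matrix.dotProduct_mulVec,
    ← Matrix.mulVec_transpose, dotProduct]
  refine Finset.sum_congr rfl fun i _ => ?_
  rw [Matrix.mulVec_diagonal]
  ring

theorem sum_sq_transpose_mulVec {Q : Matrix n n ℝ} (hQ : Q * Q.transpose = 1) (x : n → ℝ) :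
    ∑ i, (Q.transpose.mulVec x i) ^ 2 = x ⬝ᵥ x := by
  have h := dotProduct_conj_diagonal_mulVec Q 1 x
  simp only [Pi.one_apply, one_mul] at h
  rw [← h]
  have h1 : Matrix.diagonal (1 : n → ℝ) = 1 := Matrix.diagonal_one
  rw [h1, Matrix.mul_one, hQ, Matrix.one_mulVec]

/-- This is Jensen's inequality in an eigenbasis: the tangent line of `exp` at the Rayleigh
quotient, weighted by the squared coordinates of `x`, each of which is at most `x ⬝ᵥ x`. It makes
the trace exponential a test function for large quadratic forms. -/
theorem exp_rayleigh_le_trace_exp {B : Matrix n n ℝ} (hB : B.IsSymm) {x : n → ℝ}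
    (hx : 0 < x ⬝ᵥ x) :
    Real.exp (x ⬝ᵥ B.mulVec x / x ⬝ᵥ x) ≤ (NormedSpace.exp B).trace := by
  obtain ⟨Q, l, h1, h2, h3, h4⟩ := exists_orthogonal_diagonalization hB
  set y := Q.transpose.mulVec x
  set t := x ⬝ᵥ B.mulVec x / x ⬝ᵥ x with ht
  have hy : ∑ i, y i ^ 2 = x ⬝ᵥ x := sum_sq_transpose_mulVec h1 x
  have hBx : t * (x ⬝ᵥ x) = ∑ i, l i * y i ^ 2 := by
    rw [ht, div_mul_cancel₀ _ hx.ne']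
    conv_lhs => rw [h3]
    exact dotProduct_conj_diagonal_mulVec Q l x
  have htr : (NormedSpace.exp B).trace = ∑ i, Real.exp (l i) := by
    rw [h4, Matrix.trace_mul_comm, ← Matrix.mul_assoc, h2, Matrix.one_mul, Matrix.trace_diagonal]
  rw [htr]
  refine le_of_mul_le_mul_right ?_ hx
  calc Real.exp t * (x ⬝ᵥ x) = ∑ i, Real.exp t * (1 + l i - t) * y i ^ 2 := by
        have : ∑ i, Real.exp t * (1 + l i - t) * y i ^ 2
            = Real.exp t * ((1 - t) * ∑ i, y i ^ 2 + ∑ i, l i * y i ^ 2) := by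
          rw [Finset.mul_sum, ← Finset.sum_add_distrib, Finset.mul_sum]
          exact Finset.sum_congr rfl fun i _ => by ring
        rw [this, hy, ← hBx]
        ring
    _ ≤ ∑ i, Real.exp (l i) * (x ⬝ᵥ x) := by
        refine Finset.sum_le_sum fun i _ => ?_
        have e1 : Real.exp t * (1 + l i - t) ≤ Real.exp (l i) := by
          have := Real.add_one_le_exp (l i - t)
          calc Real.exp t * (1 + l i - t) ≤ Real.exp t * Real.exp (l i - t) := by
                gcongr; linarith
            _ = _ := by rw [← Real.exp_add]; congr 1; ring
        have e2 : y i ^ 2 ≤ x ⬝ᵥ x := by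
          rw [← hy]
          exact Finset.single_le_sum (f := fun i => y i ^ 2) (fun _ _ => sq_nonneg _)
            (Finset.mem_univ i)
        calc _ ≤ Real.exp (l i) * y i ^ 2 := by gcongr
          _ ≤ _ := by gcongr
    _ = _ := by rw [Finset.sum_mul]

/-- No lower bound on `x` is needed: below `-1` the right side exceeds `1`. Hence matrices need only
be bounded from above when this is applied to their eigenvalues. -/
theorem exp_le_one_add_add_sq {x : ℝ} (hx : x ≤ 1) : Real.exp x ≤ 1 + x + x ^ 2 := by
  rcases le_or_gt (-1) x with h | h
  · have := Real.abs_exp_sub_one_sub_id_le (abs_le.2 ⟨h, hx⟩)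
    linarith [le_abs_self (Real.exp x - 1 - x)]
  · have : Real.exp x ≤ 1 := Real.exp_le_one_iff.2 (by linarith)
    nlinarith

/-- In an eigenbasis of `D` both traces are sums over eigenvalues with the same nonnegative weights,
so the scalar inequality applies term by term; `hle` says that the eigenvalues are at most `1`. -/
theorem trace_mul_transpose_mul_exp_le (S : Matrix n n ℝ) {D : Matrix n n ℝ} (hD : D.IsSymm)
    (hle : ∀ x, x ⬝ᵥ D.mulVec x ≤ x ⬝ᵥ x) :
    (S * S.transpose * NormedSpace.exp D).trace ≤ (S * S.transpose * (1 + D + D ^ 2)).trace := by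
  obtain ⟨Q, l, h1, h2, h3, h4⟩ := exists_orthogonal_diagonalization hD
  have hpoly : 1 + D + D ^ 2
      = Q * Matrix.diagonal (fun i => 1 + l i + l i ^ 2) * Q.transpose := by
    have e1 : D ^ 2 = Q * (Matrix.diagonal l * Matrix.diagonal l) * Q.transpose := by
      rw [pow_two, h3]
      calc _ = Q * Matrix.diagonal l * (Q.transpose * Q) * Matrix.diagonal l * Q.transpose := by
            simp only [Matrix.mul_assoc]
        _ = _ := by rw [h2]; simp only [Matrix.mul_assoc, Matrix.one_mul]
    have e2 : Matrix.diagonal (fun i => 1 + l i + l i ^ 2)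
        = 1 + Matrix.diagonal l + Matrix.diagonal l * Matrix.diagonal l := by
      rw [Matrix.diagonal_mul_diagonal, ← Matrix.diagonal_one, Matrix.diagonal_add,
        Matrix.diagonal_add]
      congr 1
      funext i
      ring
    rw [e2, Matrix.mul_add, Matrix.mul_add, Matrix.add_mul, Matrix.add_mul, Matrix.mul_one, h1,
      ← h3, ← e1]
  have hdiag : ∀ f : n → ℝ, (S * S.transpose * (Q * Matrix.diagonal f * Q.transpose)).trace
      = ∑ i, f i * ∑ j, (S.transpose * Q) j i ^ 2 := by
    intro f
    have : S * S.transpose * (Q * Matrix.diagonal f * Q.transpose)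
        = (S * S.transpose * Q * Matrix.diagonal f) * Q.transpose := by
      simp only [Matrix.mul_assoc]
    rw [this, Matrix.trace_mul_comm]
    have : Q.transpose * (S * S.transpose * Q * Matrix.diagonal f)
        = (S.transpose * Q).transpose * (S.transpose * Q) * Matrix.diagonal f := by
      simp only [Matrix.transpose_mul, Matrix.transpose_transpose, Matrix.mul_assoc]
    rw [this]
    refine Finset.sum_congr rfl fun i _ => ?_
    rw [Matrix.diag_apply, Matrix.mul_diagonal, Matrix.mul_apply, mul_comm]
    simp only [Matrix.transpose_apply, pow_two]
  have hl : ∀ i, l i ≤ 1 := by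
    intro i
    have := hle (Q.mulVec (Pi.single i 1))
    rw [h3, dotProduct_conj_diagonal_mulVec, ← sum_sq_transpose_mulVec h1, Matrix.mulVec_mulVec, h2,
      Matrix.one_mulVec] at this
    simpa [Pi.single_apply] using this
  rw [hpoly, h4, hdiag, hdiag]
  refine Finset.sum_le_sum fun i _ => ?_
  exact mul_le_mul_of_nonneg_right (exp_le_one_add_add_sq (hl i))
    (Finset.sum_nonneg fun _ _ => sq_nonneg _)

/-- One step of the matrix Laplace transform method, for a centred two-valued random multiple
`a₁ H`, `a₀ H` of a symmetric partial isometry `H` with support projection `P`; the compensator is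
twice the variance. -/
theorem trace_exp_add_two_point_le [Nonempty n] {A H P : Matrix n n ℝ} (hA : A.IsSymm)
    (hH : H.IsSymm) (hP : P.IsSymm) (hHH : H * H = P) (hHP : H * P = H) (hPH : P * H = H)
    (hPP : P * P = P) {p a₀ a₁ b : ℝ} (hp0 : 0 ≤ p) (hp1 : p ≤ 1)
    (hmean : (1 - p) * a₀ + p * a₁ = 0) (hb : b = 2 * ((1 - p) * a₀ ^ 2 + p * a₁ ^ 2))
    (hb2 : b ≤ 1 / 2) (ha₀ : |a₀| ≤ 1) (ha₁ : |a₁| ≤ 1) :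
    (1 - p) * (NormedSpace.exp (A + (a₀ • H - b • P))).trace
      + p * (NormedSpace.exp (A + (a₁ • H - b • P))).trace ≤ (NormedSpace.exp A).trace := by
  have hb0 : 0 ≤ b := by
    rw [hb]
    have : 0 ≤ 1 - p := by linarith
    positivity
  set S : Matrix n n ℝ := NormedSpace.exp ((1 / 2 : ℝ) • A) with hS
  have hSs : S.transpose = S := ((hA.smul _).exp).eq
  have hSS : NormedSpace.exp A = S * S.transpose := by
    rw [hSs, hS, ← Matrix.exp_add_of_commute _ _ (Commute.refl _), ← add_smul]
    norm_num
  have hPx : ∀ x : n → ℝ, x ⬝ᵥ P.mulVec x = P.mulVec x ⬝ᵥ P.mulVec x := by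
    intro x
    conv_lhs => rw [← hPP]
    rw [← Matrix.mulVec_mulVec, Matrix.dotProduct_mulVec, ← Matrix.mulVec_transpose, hP.eq]
  have hHx : ∀ x : n → ℝ, H.mulVec x ⬝ᵥ H.mulVec x = x ⬝ᵥ P.mulVec x := by
    intro x
    rw [← hHH, ← Matrix.mulVec_mulVec, Matrix.dotProduct_mulVec x, ← Matrix.mulVec_transpose, hH.eq]
  have hPle : ∀ x : n → ℝ, x ⬝ᵥ P.mulVec x ≤ x ⬝ᵥ x := by
    intro x
    have := dotProduct_self_nonneg (x - P.mulVec x)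
    simp only [sub_dotProduct, dotProduct_sub] at this
    rw [dotProduct_comm (P.mulVec x) x, ← hPx] at this
    linarith
  have hPnn : ∀ x : n → ℝ, 0 ≤ x ⬝ᵥ P.mulVec x := fun x => by
    rw [hPx]; exact dotProduct_self_nonneg _
  have hHle : ∀ x : n → ℝ, |x ⬝ᵥ H.mulVec x| ≤ x ⬝ᵥ x := by
    intro x
    have e1 := dotProduct_self_nonneg (x - H.mulVec x)
    have e2 := dotProduct_self_nonneg (x + H.mulVec x)
    simp only [sub_dotProduct, dotProduct_sub, add_dotProduct, dotProduct_add] at e1 e2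
    rw [dotProduct_comm (H.mulVec x) x, hHx] at e1 e2
    have := hPle x
    rw [abs_le]
    constructor <;> linarith
  -- Golden–Thompson detaches `exp A`, and the quadratic bound on the other exponential stays in the
  -- span of `1`, `H`, `P`, because these are closed under the products that occur.
  have key : ∀ a : ℝ, |a| ≤ 1 → (NormedSpace.exp (A + (a • H - b • P))).trace ≤
      (S * S.transpose).trace + a * (1 - 2 * b) * (S * S.transpose * H).trace
        + (a ^ 2 + b ^ 2 - b) * (S * S.transpose * P).trace := by
    intro a ha
    have hD : (a • H - b • P).IsSymm := (hH.smul a).sub (hP.smul b)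
    refine (trace_exp_add_le hA hD).trans ?_
    rw [hSS]
    refine (trace_mul_transpose_mul_exp_le S hD fun x => ?_).trans_eq ?_
    · rw [Matrix.sub_mulVec, Matrix.smul_mulVec, Matrix.smul_mulVec, dotProduct_sub,
        dotProduct_smul, dotProduct_smul, smul_eq_mul, smul_eq_mul]
      have e1 : a * (x ⬝ᵥ H.mulVec x) ≤ x ⬝ᵥ x :=
        calc _ ≤ |a| * |x ⬝ᵥ H.mulVec x| := by rw [← abs_mul]; exact le_abs_self _
          _ ≤ 1 * (x ⬝ᵥ x) := by gcongr; exact hHle x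
          _ = _ := one_mul _
      have e2 := mul_nonneg hb0 (hPnn x)
      linarith
    · have e : 1 + (a • H - b • P) + (a • H - b • P) ^ 2
          = 1 + (a * (1 - 2 * b)) • H + (a ^ 2 + b ^ 2 - b) • P := by
        rw [pow_two, sub_mul, mul_sub, mul_sub]
        simp only [smul_mul_smul_comm, hHH, hHP, hPH, hPP]
        module
      rw [e]
      simp only [Matrix.mul_add, Matrix.mul_one, Matrix.mul_smul, Matrix.trace_add,
        Matrix.trace_smul, smul_eq_mul]
  have hSP : 0 ≤ (S * S.transpose * P).trace := by
    have : (S * S.transpose * P).trace = (P * S * (P * S).transpose).trace := by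
      rw [Matrix.transpose_mul, hP.eq, ← Matrix.mul_assoc, Matrix.trace_mul_comm (P * S * _) P]
      simp only [← Matrix.mul_assoc]
      rw [hPP, Matrix.trace_mul_comm, ← Matrix.mul_assoc]
    rw [this]
    exact trace_mul_transpose_self_nonneg _
  have k0 := mul_le_mul_of_nonneg_left (key a₀ ha₀) (sub_nonneg.2 hp1)
  have k1 := mul_le_mul_of_nonneg_left (key a₁ ha₁) hp0
  rw [hSS]
  set τ := (S * S.transpose).trace
  set h := (S * S.transpose * H).trace
  set q := (S * S.transpose * P).trace
  have e1 : (1 - p) * (τ + a₀ * (1 - 2 * b) * h + (a₀ ^ 2 + b ^ 2 - b) * q)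
      + p * (τ + a₁ * (1 - 2 * b) * h + (a₁ ^ 2 + b ^ 2 - b) * q)
      = τ + ((1 - p) * a₀ + p * a₁) * (1 - 2 * b) * h
        + (((1 - p) * a₀ ^ 2 + p * a₁ ^ 2) + b ^ 2 - b) * q := by ring
  have e2 : (1 - p) * a₀ ^ 2 + p * a₁ ^ 2 = b / 2 := by linarith
  rw [hmean, e2] at e1
  -- The mean-zero condition has removed the `H` term. The variance contributes `b / 2`, and `b² - b
  -- / 2 ≤ 0` because `0 ≤ b ≤ 1 / 2`: this is why the compensator is twice the variance.
  have e3 : (b / 2 + b ^ 2 - b) * q ≤ 0 :=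
    mul_nonpos_of_nonpos_of_nonneg (by nlinarith) hSP
  linarith

end TraceExp

/-! ### Matrix Bernstein bound for Bernoulli sampling. -/

section Sampling

/-- Matrix Laplace transform bound for a sum of independent two-valued random matrices. -/
theorem sum_powerset_trace_exp_le {ι n : Type*} [DecidableEq ι] [Fintype n] [DecidableEq n]
    {p : ℝ} (hp0 : 0 ≤ p) (hp1 : p ≤ 1) (D₀ D₁ : ι → Matrix n n ℝ) (s : Finset ι)
    (hs₀ : ∀ k ∈ s, (D₀ k).IsSymm) (hs₁ : ∀ k ∈ s, (D₁ k).IsSymm)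
    (hstep : ∀ k ∈ s, ∀ A : Matrix n n ℝ, A.IsSymm →
      (1 - p) * (NormedSpace.exp (A + D₀ k)).trace + p * (NormedSpace.exp (A + D₁ k)).trace
        ≤ (NormedSpace.exp A).trace)
    {A : Matrix n n ℝ} (hA : A.IsSymm) :
    ∑ t ∈ s.powerset, (∏ k ∈ s, if k ∈ t then p else 1 - p) *
        (NormedSpace.exp (A + ∑ k ∈ s, if k ∈ t then D₁ k else D₀ k)).trace
      ≤ (NormedSpace.exp A).trace := by
  induction s using Finset.induction_on generalizing A with
  | empty => simp
  | insert a s ha ih =>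
    have ih' := fun (B : Matrix n n ℝ) (hB : B.IsSymm) =>
      ih (fun k hk => hs₀ k (Finset.mem_insert_of_mem hk))
        (fun k hk => hs₁ k (Finset.mem_insert_of_mem hk))
        (fun k hk => hstep k (Finset.mem_insert_of_mem hk)) (A := B) hB
    have hmem := Finset.mem_insert_self a s
    -- Condition on whether `a` is sampled: the other indices are averaged with `A + D₀ a` or `A +
    -- D₁ a` as the fixed part, and `a` itself is averaged last.
    rw [Finset.sum_powerset_insert ha]
    have e0 : ∀ t ∈ s.powerset, (∏ k ∈ insert a s, if k ∈ t then p else 1 - p) *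
        (NormedSpace.exp (A + ∑ k ∈ insert a s, if k ∈ t then D₁ k else D₀ k)).trace
        = (1 - p) * ((∏ k ∈ s, if k ∈ t then p else 1 - p) *
          (NormedSpace.exp (A + D₀ a + ∑ k ∈ s, if k ∈ t then D₁ k else D₀ k)).trace) := by
      intro t ht
      have hat : a ∉ t := fun h => ha (Finset.mem_powerset.1 ht h)
      rw [Finset.prod_insert ha, Finset.sum_insert ha, if_neg hat, if_neg hat, add_assoc, mul_assoc]
    have e1 : ∀ t ∈ s.powerset, (∏ k ∈ insert a s, if k ∈ insert a t then p else 1 - p) *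
        (NormedSpace.exp (A + ∑ k ∈ insert a s, if k ∈ insert a t then D₁ k else D₀ k)).trace
        = p * ((∏ k ∈ s, if k ∈ t then p else 1 - p) *
          (NormedSpace.exp (A + D₁ a + ∑ k ∈ s, if k ∈ t then D₁ k else D₀ k)).trace) := by
      intro t ht
      have hk : ∀ k ∈ s, (k ∈ insert a t ↔ k ∈ t) := fun k hk => by
        rw [Finset.mem_insert, or_iff_right]
        rintro rfl
        exact ha hk
      rw [Finset.prod_insert ha, Finset.sum_insert ha, if_pos (Finset.mem_insert_self a t),
        if_pos (Finset.mem_insert_self a t), add_assoc, mul_assoc,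
        Finset.prod_congr rfl fun k h => if_congr (hk k h) rfl rfl,
        Finset.sum_congr rfl fun k h => if_congr (hk k h) rfl rfl]
    rw [Finset.sum_congr rfl e0, Finset.sum_congr rfl e1, ← Finset.mul_sum, ← Finset.mul_sum]
    have h0 := ih' (A + D₀ a) (hA.add (hs₀ a hmem))
    have h1 := ih' (A + D₁ a) (hA.add (hs₁ a hmem))
    refine le_trans ?_ (hstep a hmem A hA)
    exact add_le_add (mul_le_mul_of_nonneg_left h0 (sub_nonneg.2 hp1))
      (mul_le_mul_of_nonneg_left h1 hp0)

/-- Markov's inequality for a finite Bernoulli random set. -/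
theorem setBernoulli_real_le_sum {ι : Type*} [Fintype ι] [DecidableEq ι] (p : unitInterval)
    (B : Set (Set ι)) (f : Finset ι → ℝ) (hf : ∀ t, 0 ≤ f t)
    (hB : ∀ t : Finset ι, (t : Set ι) ∈ B → 1 ≤ f t) :
    (setBernoulli (Set.univ : Set ι) p).real B
      ≤ ∑ t ∈ Finset.univ.powerset, (∏ k, if k ∈ t then (p : ℝ) else 1 - p) * f t := by
  classical
  -- There are finitely many outcomes, so an arbitrary event is a finite union of atoms and no
  -- measurability is required of it.
  have hBu : B = ⋃ t ∈ (Finset.univ : Finset (Finset ι)).filter (fun t : Finset ι => (t : Set ι) ∈ B),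
      {(t : Set ι)} := by
    ext Ω
    simp only [Finset.mem_filter, Finset.mem_univ, true_and, Set.mem_iUnion,
      Set.mem_singleton_iff, exists_prop]
    constructor
    · intro h
      exact ⟨Ω.toFinset, by simpa using h, by simp⟩
    · rintro ⟨t, ht, rfl⟩
      exact ht
  have hw : ∀ t : Finset ι, (setBernoulli (Set.univ : Set ι) p).real {(t : Set ι)}
      = ∏ k, if k ∈ t then (p : ℝ) else 1 - p := by
    intro t
    rw [setBernoulli_real_singleton p (Set.subset_univ _) Set.finite_univ, Finset.prod_ite,
      Finset.prod_const, Finset.prod_const, Set.ncard_coe_finset]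
    congr 2
    · congr 1; ext; simp
    · rw [← Set.ncard_coe_finset]; congr 1; ext; simp
  have hw0 : ∀ t : Finset ι, 0 ≤ ∏ k, if k ∈ t then (p : ℝ) else 1 - p := fun t => by
    rw [← hw]; exact measureReal_nonneg
  rw [hBu]
  refine (measureReal_biUnion_finset_le _ _).trans ?_
  rw [Finset.powerset_univ]
  refine (Finset.sum_le_sum fun t ht => ?_).trans
    (Finset.sum_le_sum_of_subset_of_nonneg (Finset.filter_subset _ _)
      fun t _ _ => mul_nonneg (hw0 t) (hf t))
  rw [hw]
  exact le_mul_of_one_le_right (hw0 t) (hB t (Finset.mem_filter.1 ht).2)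

variable {α β : Type*} [DecidableEq α] [DecidableEq β]

/-- The symmetric dilation of the matrix unit at `k`. -/
def unitDilation (k : α × β) : Matrix (α ⊕ β) (α ⊕ β) ℝ :=
  Matrix.fromBlocks 0 (Matrix.single k.1 k.2 1) (Matrix.single k.2 k.1 1) 0

/-- The coordinate projection onto the support of `unitDilation k`. -/
def unitSupport (k : α × β) : Matrix (α ⊕ β) (α ⊕ β) ℝ :=
  Matrix.fromBlocks (Matrix.single k.1 k.1 1) 0 0 (Matrix.single k.2 k.2 1)

theorem isSymm_unitDilation (k : α × β) : (unitDilation k).IsSymm := by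
  simp [Matrix.IsSymm, unitDilation, Matrix.fromBlocks_transpose]

theorem isSymm_unitSupport (k : α × β) : (unitSupport k).IsSymm := by
  simp [Matrix.IsSymm, unitSupport, Matrix.fromBlocks_transpose]

variable [Fintype α] [Fintype β]

theorem unitDilation_mul_self (k : α × β) : unitDilation k * unitDilation k = unitSupport k := by
  simp [unitSupport, unitDilation, Matrix.fromBlocks_multiply]

theorem unitDilation_mul_unitSupport (k : α × β) :
    unitDilation k * unitSupport k = unitDilation k := by
  simp [unitSupport, unitDilation, Matrix.fromBlocks_multiply]

theorem unitSupport_mul_unitDilation (k : α × β) :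
    unitSupport k * unitDilation k = unitDilation k := by
  simp [unitSupport, unitDilation, Matrix.fromBlocks_multiply]

theorem unitSupport_mul_self (k : α × β) : unitSupport k * unitSupport k = unitSupport k := by
  simp [unitSupport, Matrix.fromBlocks_multiply]

theorem dotProduct_unitDilation_mulVec (k : α × β) (u : α → ℝ) (v : β → ℝ) :
    Sum.elim u v ⬝ᵥ (unitDilation k).mulVec (Sum.elim u v) = 2 * (u k.1 * v k.2) := by
  rw [unitDilation, Matrix.fromBlocks_mulVec]
  simp [Matrix.single_mulVec, Function.update_apply, dotProduct, Fintype.sum_sum_type]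
  ring

theorem dotProduct_unitSupport_mulVec (k : α × β) (u : α → ℝ) (v : β → ℝ) :
    Sum.elim u v ⬝ᵥ (unitSupport k).mulVec (Sum.elim u v) = u k.1 ^ 2 + v k.2 ^ 2 := by
  rw [unitSupport, Matrix.fromBlocks_mulVec]
  simp [Matrix.single_mulVec, Function.update_apply, dotProduct, Fintype.sum_sum_type]
  ring

theorem dotProduct_sum_mulVec {ι n : Type*} [Fintype n] (s : Finset ι) (D : ι → Matrix n n ℝ)
    (x : n → ℝ) : x ⬝ᵥ (∑ k ∈ s, D k).mulVec x = ∑ k ∈ s, x ⬝ᵥ (D k).mulVec x := by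
  rw [Matrix.sum_mulVec, dotProduct_sum]

theorem dotProduct_mulVec_eq_sum_prod {m n : Type*} [Fintype m] [Fintype n] (W : Matrix m n ℝ)
    (u : m → ℝ) (v : n → ℝ) : u ⬝ᵥ W.mulVec v = ∑ k : m × n, W k.1 k.2 * (u k.1 * v k.2) := by
  rw [Fintype.sum_prod_type]
  simp only [dotProduct, Matrix.mulVec, Finset.mul_sum]
  exact Finset.sum_congr rfl fun i _ => Finset.sum_congr rfl fun j _ => by ring

/-- **Matrix Bernstein inequality** for the rescaled sampling operator, in Laplace transform form:
`θ` is the free parameter of the transform and `ν` bounds the squared row and column norms. -/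
theorem setBernoulli_real_not_le {n₁ n₂ : ℕ} [Nonempty (Fin n₁ ⊕ Fin n₂)]
    (X : Matrix (Fin n₁) (Fin n₂) ℝ) (p : unitInterval) (hp : 0 < (p : ℝ)) {θ ν : ℝ} (s : ℝ)
    (hθ : 0 ≤ θ) (hX : ∀ i j, θ * |X i j| ≤ p / 2) (hrow : ∀ i, ∑ j, X i j ^ 2 ≤ ν)
    (hcol : ∀ j, ∑ i, X i j ^ 2 ≤ ν) :
    (setBernoulli (Set.univ : Set (Fin n₁ × Fin n₂)) p).real
      {Ω | ¬ ∀ u v, 2 * (u ⬝ᵥ ((p : ℝ)⁻¹ • sampleProj Ω X - X).mulVec v) ≤ s * (u ⬝ᵥ u + v ⬝ᵥ v)}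
      ≤ (n₁ + n₂) * Real.exp (2 * θ ^ 2 * ν / p - θ * s) := by
  classical
  set q : ℝ := (p : ℝ) with hq
  have hq1 : q ≤ 1 := p.2.2
  -- `a₀` and `a₁` are the values of `θ W k` when the entry `k` is missed and when it is sampled.
  set a₀ : Fin n₁ × Fin n₂ → ℝ := fun k => -(θ * X k.1 k.2) with ha₀
  set a₁ : Fin n₁ × Fin n₂ → ℝ := fun k => θ * X k.1 k.2 * (q⁻¹ - 1) with ha₁
  set b : Fin n₁ × Fin n₂ → ℝ := fun k => 2 * ((1 - q) * a₀ k ^ 2 + q * a₁ k ^ 2) with hb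
  have hbval : ∀ k, b k = 2 * θ ^ 2 * X k.1 k.2 ^ 2 * ((1 - q) / q) := by
    intro k
    simp only [hb, ha₀, ha₁]
    field_simp
    ring
  have habs : ∀ k : Fin n₁ × Fin n₂, |θ * X k.1 k.2| ≤ q / 2 := fun k => by
    rw [abs_mul, abs_of_nonneg hθ]; exact hX _ _
  have hble : ∀ k, b k ≤ 2 * θ ^ 2 / q * X k.1 k.2 ^ 2 := by
    intro k
    rw [hbval]
    have : (1 - q) / q ≤ 1 / q := by gcongr; linarith
    calc _ ≤ 2 * θ ^ 2 * X k.1 k.2 ^ 2 * (1 / q) := by gcongr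
      _ = _ := by ring
  have hb2 : ∀ k, b k ≤ 1 / 2 := by
    intro k
    have h1 : (θ * X k.1 k.2) ^ 2 ≤ (q / 2) ^ 2 := sq_le_sq' (by linarith [(abs_le.1 (habs k)).1])
      (abs_le.1 (habs k)).2
    refine (hble k).trans ?_
    calc 2 * θ ^ 2 / q * X k.1 k.2 ^ 2 = 2 / q * (θ * X k.1 k.2) ^ 2 := by ring
      _ ≤ 2 / q * (q / 2) ^ 2 := by gcongr
      _ = q / 2 := by field_simp
      _ ≤ 1 / 2 := by linarith
  have hA₀ : ∀ k, |a₀ k| ≤ 1 := fun k => by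
    simp only [ha₀]
    rw [abs_neg]
    linarith [habs k]
  have hA₁ : ∀ k, |a₁ k| ≤ 1 := fun k => by
    have h1 : 0 ≤ q⁻¹ - 1 := sub_nonneg.2 ((one_le_inv₀ hp).2 hq1)
    simp only [ha₁]
    rw [abs_mul, abs_of_nonneg h1]
    calc _ ≤ q / 2 * (q⁻¹ - 1) := by gcongr; exact habs k
      _ = 1 / 2 - q / 2 := by field_simp
      _ ≤ 1 := by linarith
  set D₀ := fun k => a₀ k • unitDilation k - b k • unitSupport k with hD₀
  set D₁ := fun k => a₁ k • unitDilation k - b k • unitSupport k with hD₁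
  have hs₀ : ∀ k, (D₀ k).IsSymm := fun k =>
    ((isSymm_unitDilation k).smul _).sub ((isSymm_unitSupport k).smul _)
  have hs₁ : ∀ k, (D₁ k).IsSymm := fun k =>
    ((isSymm_unitDilation k).smul _).sub ((isSymm_unitSupport k).smul _)
  -- Starting from the zero matrix, the bound is the trace of the identity, that is `n₁ + n₂`.
  have hmgf := sum_powerset_trace_exp_le hp.le hq1 D₀ D₁ Finset.univ (fun k _ => hs₀ k)
    (fun k _ => hs₁ k) (fun k _ A hA => trace_exp_add_two_point_le hA (isSymm_unitDilation k)
      (isSymm_unitSupport k) (unitDilation_mul_self k) (unitDilation_mul_unitSupport k)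
      (unitSupport_mul_unitDilation k) (unitSupport_mul_self k) hp.le hq1
      (by simp only [ha₀, ha₁]; field_simp; ring) rfl (hb2 k) (hA₀ k) (hA₁ k))
    (Matrix.isSymm_zero (n := Fin n₁ ⊕ Fin n₂) (α := ℝ))
  simp only [zero_add, NormedSpace.exp_zero, Matrix.trace_one, Fintype.card_sum,
    Fintype.card_fin, Nat.cast_add] at hmgf
  set K := Real.exp (2 * θ ^ 2 * ν / q - θ * s) with hK
  have hKpos : 0 < K := Real.exp_pos _
  set S := fun t : Finset (Fin n₁ × Fin n₂) => ∑ k, if k ∈ t then D₁ k else D₀ k with hS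
  have hSsymm : ∀ t, (S t).IsSymm := fun t => by
    rw [Matrix.IsSymm, hS]
    simp only [Matrix.transpose_sum]
    refine Finset.sum_congr rfl fun k _ => ?_
    split_ifs
    exacts [(hs₁ k).eq, (hs₀ k).eq]
  have htr : ∀ t, 0 ≤ (NormedSpace.exp (S t)).trace := fun t => by
    obtain ⟨i⟩ := ‹Nonempty (Fin n₁ ⊕ Fin n₂)›
    exact (Real.exp_nonneg _).trans
      (exp_rayleigh_le_trace_exp (hSsymm t) (x := Pi.single i 1) (by simp))
  refine (setBernoulli_real_le_sum p _ (fun t => (NormedSpace.exp (S t)).trace * K)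
    (fun t => mul_nonneg (htr t) hKpos.le) fun t ht => ?_).trans ?_
  · simp only [Set.mem_ofPred_eq, not_forall, not_le] at ht
    obtain ⟨u, v, huv⟩ := ht
    set W := q⁻¹ • sampleProj (t : Set (Fin n₁ × Fin n₂)) X - X with hW
    set N := u ⬝ᵥ u + v ⬝ᵥ v with hN
    have hxx : Sum.elim u v ⬝ᵥ Sum.elim u v = N := by
      simp [dotProduct, Fintype.sum_sum_type, hN]
    have hNpos : 0 < N := by
      refine lt_of_le_of_ne (add_nonneg (dotProduct_self_nonneg u) (dotProduct_self_nonneg v))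
        fun h0 => ?_
      have hu : u = 0 := dotProduct_self_eq_zero.1 (le_antisymm
        (by linarith [dotProduct_self_nonneg v]) (dotProduct_self_nonneg u))
      rw [← h0, hu] at huv
      simp at huv
    have hquad : Sum.elim u v ⬝ᵥ (S t).mulVec (Sum.elim u v)
        = θ * (2 * (u ⬝ᵥ W.mulVec v)) - ∑ k, b k * (u k.1 ^ 2 + v k.2 ^ 2) := by
      rw [hS, dotProduct_sum_mulVec, dotProduct_mulVec_eq_sum_prod, Finset.mul_sum, Finset.mul_sum,
        ← Finset.sum_sub_distrib]
      refine Finset.sum_congr rfl fun k _ => ?_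
      have hWk : W k.1 k.2 = q⁻¹ * (if k ∈ t then X k.1 k.2 else 0) - X k.1 k.2 := by
        simp [hW, sampleProj]
      rw [hWk]
      split_ifs
      · rw [hD₁, Matrix.sub_mulVec, Matrix.smul_mulVec, Matrix.smul_mulVec, dotProduct_sub,
          dotProduct_smul, dotProduct_smul, dotProduct_unitDilation_mulVec,
          dotProduct_unitSupport_mulVec]
        simp only [ha₁, smul_eq_mul]
        ring
      · rw [hD₀, Matrix.sub_mulVec, Matrix.smul_mulVec, Matrix.smul_mulVec, dotProduct_sub,
          dotProduct_smul, dotProduct_smul, dotProduct_unitDilation_mulVec,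
          dotProduct_unitSupport_mulVec]
        simp only [ha₀, smul_eq_mul]
        ring
    have hvar : ∑ k, b k * (u k.1 ^ 2 + v k.2 ^ 2) ≤ 2 * θ ^ 2 * ν / q * N := by
      calc ∑ k, b k * (u k.1 ^ 2 + v k.2 ^ 2)
          ≤ ∑ k : Fin n₁ × Fin n₂, 2 * θ ^ 2 / q * X k.1 k.2 ^ 2 * (u k.1 ^ 2 + v k.2 ^ 2) :=
            Finset.sum_le_sum fun k _ => by gcongr; exact hble k
        _ = 2 * θ ^ 2 / q * (∑ i, u i ^ 2 * ∑ j, X i j ^ 2 + ∑ j, v j ^ 2 * ∑ i, X i j ^ 2) := by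
            simp only [mul_add, Finset.sum_add_distrib, Finset.mul_sum]
            rw [Fintype.sum_prod_type, Fintype.sum_prod_type_right]
            congr 1 <;>
            exact Finset.sum_congr rfl fun i _ => Finset.sum_congr rfl fun j _ => by ring
        _ ≤ 2 * θ ^ 2 / q * (∑ i, u i ^ 2 * ν + ∑ j, v j ^ 2 * ν) := by
            gcongr
            · exact hrow _
            · exact hcol _
        _ = _ := by
            rw [← Finset.sum_mul, ← Finset.sum_mul, hN]
            simp only [dotProduct, ← pow_two]
            ring
    have hexp := exp_rayleigh_le_trace_exp (hSsymm t) (x := Sum.elim u v) (by rw [hxx]; exact hNpos)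
    -- A pair `(u, v)` violating the bound is stacked into one test vector: the dilation contributes
    -- more than `θ s` to its Rayleigh quotient, and the compensators remove at most `2 θ² ν / p`.
    have hge : θ * s - 2 * θ ^ 2 * ν / q
        ≤ Sum.elim u v ⬝ᵥ (S t).mulVec (Sum.elim u v) / Sum.elim u v ⬝ᵥ Sum.elim u v := by
      rw [hxx, le_div_iff₀ hNpos, hquad]
      have := mul_le_mul_of_nonneg_left huv.le hθ
      linarith
    calc (1 : ℝ) = Real.exp (θ * s - 2 * θ ^ 2 * ν / q) * K := by
          rw [hK, ← Real.exp_add]; simp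
      _ ≤ _ := by
          gcongr
          exact (Real.exp_le_exp.2 hge).trans hexp
  · calc _ = (∑ t ∈ Finset.univ.powerset, (∏ k, if k ∈ t then q else 1 - q) *
            (NormedSpace.exp (S t)).trace) * K := by
          rw [Finset.sum_mul]
          exact Finset.sum_congr rfl fun t _ => by ring
      _ ≤ _ := by gcongr

end Sampling

/-! ### Weyl's inequality and the error of rank-`r` truncation. -/

section SingularValues

theorem mulVec_dotProduct_mulVec_of_orthonormal {m k : Type*} [Fintype m] [Fintype k]
    [DecidableEq k] {U : Matrix m k ℝ} (hU : U.transpose * U = 1) (x y : k → ℝ) :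
    U.mulVec x ⬝ᵥ U.mulVec y = x ⬝ᵥ y := by
  rw [Matrix.dotProduct_mulVec, ← Matrix.mulVec_transpose, Matrix.mulVec_mulVec, hU,
    Matrix.one_mulVec]

/-- Bessel's inequality for the columns of a matrix. -/
theorem transpose_mulVec_dotProduct_le {m k : Type*} [Fintype m] [Fintype k]
    [DecidableEq k] {V : Matrix m k ℝ} (hV : V.transpose * V = 1) (y : m → ℝ) :
    V.transpose.mulVec y ⬝ᵥ V.transpose.mulVec y ≤ y ⬝ᵥ y := by
  have h := dotProduct_self_nonneg (y - V.mulVec (V.transpose.mulVec y))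
  have h1 : y ⬝ᵥ V.mulVec (V.transpose.mulVec y)
      = V.transpose.mulVec y ⬝ᵥ V.transpose.mulVec y := by
    rw [Matrix.dotProduct_mulVec, ← Matrix.mulVec_transpose]
  simp only [sub_dotProduct, dotProduct_sub] at h
  rw [dotProduct_comm (V.mulVec _) y, mulVec_dotProduct_mulVec_of_orthonormal hV, h1] at h
  linarith

theorem sum_sq_eq_trace {m n : Type*} [Fintype m] [Fintype n] (A : Matrix m n ℝ) :
    ∑ i, ∑ j, A i j ^ 2 = (A * A.transpose).trace := by
  simp only [Matrix.trace, Matrix.diag, Matrix.mul_apply, Matrix.transpose_apply, pow_two]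

/-- The squared Frobenius norm is at most the rank times the squared operator norm. -/
theorem sum_sq_le_of_rank_le {n₁ n₂ k : ℕ} (A : Matrix (Fin n₁) (Fin n₂) ℝ) (hk : A.rank ≤ k)
    {t : ℝ} (ht : ∀ y, A.mulVec y ⬝ᵥ A.mulVec y ≤ t ^ 2 * (y ⬝ᵥ y)) :
    ∑ i, ∑ j, A i j ^ 2 ≤ k * t ^ 2 := by
  obtain ⟨U, σ, V, h⟩ := exists_isSVD A
  have h1 : ∑ i, ∑ j, A i j ^ 2 = ∑ i, σ i ^ 2 := by
    have e1 : A * A.transpose = U * (Matrix.diagonal σ * Matrix.diagonal σ * U.transpose) := by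
      rw [h.eq_mul]
      simp only [Matrix.transpose_mul, Matrix.transpose_transpose, Matrix.diagonal_transpose]
      calc _ = U * (Matrix.diagonal σ * (V.transpose * V) * Matrix.diagonal σ * U.transpose) := by
            simp only [Matrix.mul_assoc]
        _ = _ := by rw [h.orthonormal_right, Matrix.mul_one]
    rw [sum_sq_eq_trace, e1, Matrix.trace_mul_comm, Matrix.mul_assoc, h.orthonormal_left,
      Matrix.mul_one, Matrix.diagonal_mul_diagonal, Matrix.trace_diagonal]
    simp only [pow_two]
  have h2 : ∀ i, σ i ^ 2 ≤ t ^ 2 := by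
    intro i
    have := ht (V.mulVec (Pi.single i 1))
    have e : A.mulVec (V.mulVec (Pi.single i 1)) = U.mulVec (σ i • Pi.single i 1) := by
      conv_lhs => rw [h.eq_mul]
      rw [Matrix.mulVec_mulVec, Matrix.mul_assoc, h.orthonormal_right, Matrix.mul_one,
        ← Matrix.mulVec_mulVec, Matrix.diagonal_mulVec_single]
      congr 1
      simp [← Pi.single_smul]
    rw [e, mulVec_dotProduct_mulVec_of_orthonormal h.orthonormal_left,
      mulVec_dotProduct_mulVec_of_orthonormal h.orthonormal_right] at this
    simpa [pow_two] using this
  have h3 : Fintype.card {i // σ i ≠ 0} ≤ k := by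
    rw [← Matrix.rank_diagonal]
    have e : Matrix.diagonal σ = U.transpose * A * V := by
      conv_rhs => rw [h.eq_mul]
      calc _ = 1 * Matrix.diagonal σ * 1 := by simp
        _ = (U.transpose * U) * Matrix.diagonal σ * (V.transpose * V) := by
          rw [h.orthonormal_left, h.orthonormal_right]
        _ = _ := by simp only [Matrix.mul_assoc]
    rw [e]
    exact (Matrix.rank_mul_le_left _ _).trans ((Matrix.rank_mul_le_right _ _).trans hk)
  rw [h1]
  classical
  calc ∑ i, σ i ^ 2 = ∑ i ∈ Finset.univ.filter (fun i => σ i ≠ 0), σ i ^ 2 := by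
        rw [Finset.sum_filter]
        refine Finset.sum_congr rfl fun i _ => ?_
        split_ifs with h0
        · rfl
        · rw [not_not.1 h0]; simp
    _ ≤ ∑ i ∈ Finset.univ.filter (fun i => σ i ≠ 0), t ^ 2 := Finset.sum_le_sum fun i _ => h2 i
    _ = (Fintype.card {i // σ i ≠ 0} : ℝ) * t ^ 2 := by
        rw [Finset.sum_const, nsmul_eq_mul, Fintype.card_subtype]
    _ ≤ k * t ^ 2 := by gcongr

/-- **Weyl's inequality**: a perturbation of size `s` of a matrix factoring through `ℝ^r` has
singular values at most `s` from the `r`-th one on. -/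
theorem IsSVD.le_of_rank_le_add {n₁ n₂ k r : ℕ} {M W : Matrix (Fin n₁) (Fin n₂) ℝ}
    {U : Matrix (Fin n₁) (Fin k) ℝ} {σ : Fin k → ℝ} {V : Matrix (Fin n₂) (Fin k) ℝ}
    (h : IsSVD M U σ V) (B : Matrix (Fin n₁) (Fin r) ℝ) (C : Matrix (Fin r) (Fin n₂) ℝ)
    (hM : M = B * C + W) {s : ℝ} (hs : 0 ≤ s)
    (hW : ∀ y, W.mulVec y ⬝ᵥ W.mulVec y ≤ s ^ 2 * (y ⬝ᵥ y)) (j : Fin k) (hj : r ≤ j) :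
    σ j ≤ s := by
  have hrk : r + 1 ≤ k := by omega
  set e : Fin (r + 1) → Fin k := Fin.castLE hrk with he
  have hei : Function.Injective e := Fin.castLE_injective hrk
  set U' := U.submatrix id e
  set V' := V.submatrix id e
  have hsub : ∀ {n : ℕ} (Q : Matrix (Fin n) (Fin k) ℝ), Q.transpose * Q = 1 →
      (Q.submatrix id e).transpose * Q.submatrix id e = 1 := by
    intro n Q hQ
    have h1 : (Q.transpose * Q).submatrix e e = 1 := by rw [hQ, Matrix.submatrix_one e hei]
    rw [← h1]
    rfl
  have hU' : U'.transpose * U' = 1 := hsub U h.orthonormal_left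
  have hV' : V'.transpose * V' = 1 := hsub V h.orthonormal_right
  have hMV : M * V' = U' * Matrix.diagonal (σ ∘ e) := by
    have e1 : M * V = U * Matrix.diagonal σ := by
      rw [h.eq_mul, Matrix.mul_assoc, h.orthonormal_right, Matrix.mul_one]
    ext i l
    have := congrFun (congrFun e1 i) (e l)
    rw [Matrix.mul_diagonal] at this ⊢
    rw [Matrix.mul_apply] at this ⊢
    exact this
  -- Dimension count: `C` has only `r` rows, so it kills a nonzero combination of the first `r + 1`
  -- right singular vectors. On that combination `M` acts as `W`, yet stretches by at least `σ j`.
  obtain ⟨z, hz, hz0⟩ : ∃ z : Fin (r + 1) → ℝ, z ≠ 0 ∧ (C * V').mulVec z = 0 := by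
    have hker := LinearMap.ker_ne_bot_of_finrank_lt (f := Matrix.toLin' (C * V')) (by simp)
    obtain ⟨z, hz, hz0⟩ := Submodule.exists_mem_ne_zero_of_ne_bot hker
    exact ⟨z, hz0, by simpa using hz⟩
  have hzz : 0 < z ⬝ᵥ z :=
    lt_of_le_of_ne (dotProduct_self_nonneg z) fun h0 => hz (dotProduct_self_eq_zero.1 h0.symm)
  have hWz : W.mulVec (V'.mulVec z) = U'.mulVec ((Matrix.diagonal (σ ∘ e)).mulVec z) := by
    have : W = M - B * C := by rw [hM]; simp
    rw [this, Matrix.sub_mulVec, ← Matrix.mulVec_mulVec, Matrix.mulVec_mulVec (M := C), hz0,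
      Matrix.mulVec_zero, sub_zero, Matrix.mulVec_mulVec, hMV, ← Matrix.mulVec_mulVec]
  have hb := hW (V'.mulVec z)
  rw [hWz, mulVec_dotProduct_mulVec_of_orthonormal hU',
    mulVec_dotProduct_mulVec_of_orthonormal hV'] at hb
  have hσ : σ j ^ 2 * (z ⬝ᵥ z)
      ≤ (Matrix.diagonal (σ ∘ e)).mulVec z ⬝ᵥ (Matrix.diagonal (σ ∘ e)).mulVec z := by
    simp only [dotProduct, Finset.mul_sum, Matrix.mulVec_diagonal]
    refine Finset.sum_le_sum fun i _ => ?_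
    have h1 : σ j ≤ σ (e i) := h.antitone (by
      rw [Fin.le_def]
      have := i.2
      simp only [he, Fin.val_castLE]
      omega)
    have h2 : σ j ^ 2 ≤ σ (e i) ^ 2 := pow_le_pow_left₀ (h.nonneg j) h1 2
    calc _ ≤ σ (e i) ^ 2 * (z i * z i) := mul_le_mul_of_nonneg_right h2 (mul_self_nonneg _)
      _ = _ := by simp only [Function.comp_apply]; ring
  have := le_of_mul_le_mul_right (hσ.trans hb) hzz
  exact le_of_sq_le_sq this hs

/-- The tail of an SVD whose discarded singular values are at most `s` has operator norm at most
`s`. -/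
theorem IsTruncatedSVD.sub_mulVec_le {n₁ n₂ r : ℕ} {M W : Matrix (Fin n₁) (Fin n₂) ℝ}
    {U : Matrix (Fin n₁) (Fin r) ℝ} {σ : Fin r → ℝ} {V : Matrix (Fin n₂) (Fin r) ℝ}
    (h : IsTruncatedSVD M U σ V) (B : Matrix (Fin n₁) (Fin r) ℝ) (C : Matrix (Fin r) (Fin n₂) ℝ)
    (hM : M = B * C + W) {s : ℝ} (hs : 0 ≤ s)
    (hW : ∀ y, W.mulVec y ⬝ᵥ W.mulVec y ≤ s ^ 2 * (y ⬝ᵥ y)) (y : Fin n₂ → ℝ) :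
    (M - U * Matrix.diagonal σ * V.transpose).mulVec y ⬝ᵥ
      (M - U * Matrix.diagonal σ * V.transpose).mulVec y ≤ s ^ 2 * (y ⬝ᵥ y) := by
  obtain ⟨U', σ', V', hr, h', hU, hσ, hV⟩ := h
  -- The remainder has the same singular vectors, with the first `r` singular values replaced by
  -- zero; Weyl's inequality bounds the others.
  set τ : Fin (min n₁ n₂) → ℝ := fun j => if (j : ℕ) < r then 0 else σ' j with hτ
  have hsub : M - U * Matrix.diagonal σ * V.transpose = U' * Matrix.diagonal τ * V'.transpose := by
    rw [h'.eq_mul]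
    ext i l
    rw [Matrix.sub_apply, Matrix.mul_apply, Matrix.mul_apply, Matrix.mul_apply, sub_eq_iff_eq_add]
    simp only [Matrix.mul_diagonal, Matrix.transpose_apply, hU, hσ, hV]
    have e : ∑ x, U' i (Fin.castLE hr x) * σ' (Fin.castLE hr x) * V' l (Fin.castLE hr x)
        = ∑ j : Fin (min n₁ n₂), if (j : ℕ) < r then U' i j * σ' j * V' l j else 0 := by
      refine Finset.sum_of_injOn (Fin.castLE hr) (Fin.castLE_injective hr).injOn (by simp) ?_ ?_
      · intro j _ hj
        rw [if_neg]
        intro hlt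
        exact hj ⟨⟨j, hlt⟩, by simp, rfl⟩
      · intro j _
        simp
    rw [e, ← Finset.sum_add_distrib]
    refine Finset.sum_congr rfl fun j _ => ?_
    simp only [hτ]
    split_ifs <;> simp
  have hτs : ∀ j, τ j ^ 2 ≤ s ^ 2 := by
    intro j
    simp only [hτ]
    split_ifs with hj
    · rw [zero_pow two_ne_zero]
      exact sq_nonneg s
    · exact pow_le_pow_left₀ (h'.nonneg j) (h'.le_of_rank_le_add B C hM hs hW j (not_lt.1 hj)) 2
  rw [hsub, ← Matrix.mulVec_mulVec, ← Matrix.mulVec_mulVec,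
    mulVec_dotProduct_mulVec_of_orthonormal h'.orthonormal_left]
  refine le_trans ?_ (mul_le_mul_of_nonneg_left
    (transpose_mulVec_dotProduct_le h'.orthonormal_right y) (sq_nonneg s))
  simp only [dotProduct, Finset.mul_sum, Matrix.mulVec_diagonal]
  refine Finset.sum_le_sum fun j _ => ?_
  calc _ = τ j ^ 2 * (V'.transpose.mulVec y j * V'.transpose.mulVec y j) := by ring
    _ ≤ _ := mul_le_mul_of_nonneg_right (hτs j) (mul_self_nonneg _)

/-- Rank-`r` truncation of a perturbed rank-`r` matrix: Frobenius error bound. -/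
theorem IsTruncatedSVD.sum_sq_sub_le {n₁ n₂ r : ℕ} {X M : Matrix (Fin n₁) (Fin n₂) ℝ}
    {U : Matrix (Fin n₁) (Fin r) ℝ} {σ : Fin r → ℝ} {V : Matrix (Fin n₂) (Fin r) ℝ}
    {U₀ : Matrix (Fin n₁) (Fin r) ℝ} {σ₀ : Fin r → ℝ} {V₀ : Matrix (Fin n₂) (Fin r) ℝ}
    (h : IsTruncatedSVD M U₀ σ₀ V₀) (hX : X = U * Matrix.diagonal σ * V.transpose) {s : ℝ}
    (hs : 0 ≤ s) (hW : ∀ y, (M - X).mulVec y ⬝ᵥ (M - X).mulVec y ≤ s ^ 2 * (y ⬝ᵥ y)) :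
    ∑ i, ∑ j, (U₀ * Matrix.diagonal σ₀ * V₀.transpose - X) i j ^ 2 ≤ 8 * r * s ^ 2 := by
  set X₀ := U₀ * Matrix.diagonal σ₀ * V₀.transpose with hX₀
  have hrank : (X₀ - X).rank ≤ 2 * r := by
    have e : X₀ - X = Matrix.fromCols (U₀ * Matrix.diagonal σ₀) (-(U * Matrix.diagonal σ))
        * Matrix.fromRows V₀.transpose V.transpose := by
      rw [Matrix.fromCols_mul_fromRows, hX, hX₀, Matrix.neg_mul, sub_eq_add_neg]
    rw [e]
    refine (Matrix.rank_mul_le_left _ _).trans ((Matrix.rank_le_card_width _).trans ?_)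
    simp [two_mul]
  -- Both `M - X` and `M - X₀` are bounded by `s`, and `|a - b|² ≤ 2 |a|² + 2 |b|²`. Together with
  -- rank `2 r` this gives `2 r (2 s)² = 8 r s²`.
  have hop : ∀ y, (X₀ - X).mulVec y ⬝ᵥ (X₀ - X).mulVec y ≤ (2 * s) ^ 2 * (y ⬝ᵥ y) := by
    intro y
    have h1 := hW y
    have h2 := h.sub_mulVec_le (U * Matrix.diagonal σ) V.transpose (W := M - X)
      (by rw [← hX]; simp) hs hW y
    rw [← hX₀] at h2
    have e : X₀ - X = (M - X) - (M - X₀) := by abel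
    rw [e, Matrix.sub_mulVec]
    set a := (M - X).mulVec y
    set b := (M - X₀).mulVec y
    have h3 := dotProduct_self_nonneg (a + b)
    simp only [sub_dotProduct, dotProduct_sub, add_dotProduct, dotProduct_add] at h3 ⊢
    rw [dotProduct_comm b a] at h3 ⊢
    linarith
  refine (sum_sq_le_of_rank_le _ hrank hop).trans_eq ?_
  push_cast
  ring

end SingularValues

/-! ### From Gram matrices back to factors, up to rotation. -/

section Procrustes

theorem trace_transpose_mul_self_nonneg {m n : Type*} [Fintype m] [Fintype n] (M : Matrix m n ℝ) :
    0 ≤ (M.transpose * M).trace := by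
  have := trace_mul_transpose_self_nonneg M.transpose
  rwa [Matrix.transpose_transpose] at this

theorem trace_fromBlocks_eq_add {m n : Type*} [Fintype m] [Fintype n] (A : Matrix m m ℝ)
    (B : Matrix m n ℝ) (C : Matrix n m ℝ) (D : Matrix n n ℝ) :
    (Matrix.fromBlocks A B C D).trace = A.trace + D.trace := by
  simp [Matrix.trace, Fintype.sum_sum_type]

/-- The difference of the Gram matrices of two balanced stacked factors is controlled by its
off-diagonal block. -/
theorem trace_gram_sub_sq_le {m n r : Type*} [Fintype m] [Fintype n] [Fintype r] [DecidableEq m]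
    [DecidableEq n] {A₀ A : Matrix m r ℝ} {B₀ B : Matrix n r ℝ}
    (h₀ : A₀.transpose * A₀ = B₀.transpose * B₀) (h : A.transpose * A = B.transpose * B) :
    ((Matrix.fromRows A₀ B₀ * (Matrix.fromRows A₀ B₀).transpose
        - Matrix.fromRows A B * (Matrix.fromRows A B).transpose) ^ 2).trace
      ≤ 4 * ∑ i, ∑ j, (A₀ * B₀.transpose - A * B.transpose) i j ^ 2 := by
  set E := A₀ * A₀.transpose - A * A.transpose with hE
  set F := A₀ * B₀.transpose - A * B.transpose with hF
  set G := B₀ * B₀.transpose - B * B.transpose with hG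
  have hblock : Matrix.fromRows A₀ B₀ * (Matrix.fromRows A₀ B₀).transpose
        - Matrix.fromRows A B * (Matrix.fromRows A B).transpose
      = Matrix.fromBlocks E F F.transpose G := by
    rw [Matrix.transpose_fromRows, Matrix.transpose_fromRows, Matrix.fromRows_mul_fromCols,
      Matrix.fromRows_mul_fromCols, sub_eq_add_neg,
      Matrix.fromBlocks_neg, Matrix.fromBlocks_add, hF, Matrix.transpose_sub]
    simp only [Matrix.transpose_mul, Matrix.transpose_transpose, hE, hG, ← sub_eq_add_neg]
  rw [hblock, pow_two, Matrix.fromBlocks_multiply, trace_fromBlocks_eq_add, Matrix.trace_add,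
    Matrix.trace_add, sum_sq_eq_trace, Matrix.trace_mul_comm F.transpose F]
  -- Thanks to balance, the right side minus the left side is exactly twice the squared Frobenius
  -- norm of `A₀ᵀ A - B₀ᵀ B`.
  have hmain : (E * E).trace + (G * G).trace ≤ 2 * (F * F.transpose).trace := by
    have hN := trace_transpose_mul_self_nonneg (A₀.transpose * A - B₀.transpose * B)
    have t1 : (E * E).trace = (A₀.transpose * A₀ * (A₀.transpose * A₀)).trace
        - 2 * ((A₀.transpose * A).transpose * (A₀.transpose * A)).trace
        + (A.transpose * A * (A.transpose * A)).trace := by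
      have c1 : (A₀ * A₀.transpose * (A₀ * A₀.transpose)).trace
          = (A₀.transpose * A₀ * (A₀.transpose * A₀)).trace := by
        rw [Matrix.mul_assoc, Matrix.trace_mul_comm]; simp only [Matrix.mul_assoc]
      have c2 : (A * A.transpose * (A * A.transpose)).trace
          = (A.transpose * A * (A.transpose * A)).trace := by
        rw [Matrix.mul_assoc, Matrix.trace_mul_comm]; simp only [Matrix.mul_assoc]
      have c3 : (A * A.transpose * (A₀ * A₀.transpose)).trace
          = ((A₀.transpose * A).transpose * (A₀.transpose * A)).trace := by
        rw [Matrix.mul_assoc, Matrix.trace_mul_comm]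
        simp only [Matrix.mul_assoc, Matrix.transpose_mul, Matrix.transpose_transpose]
      have c4 := Matrix.trace_mul_comm (A₀ * A₀.transpose) (A * A.transpose)
      simp only [hE, Matrix.sub_mul, Matrix.mul_sub, Matrix.trace_sub]
      linarith
    have t2 : (G * G).trace = (B₀.transpose * B₀ * (B₀.transpose * B₀)).trace
        - 2 * ((B₀.transpose * B).transpose * (B₀.transpose * B)).trace
        + (B.transpose * B * (B.transpose * B)).trace := by
      have c1 : (B₀ * B₀.transpose * (B₀ * B₀.transpose)).trace
          = (B₀.transpose * B₀ * (B₀.transpose * B₀)).trace := by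
        rw [Matrix.mul_assoc, Matrix.trace_mul_comm]; simp only [Matrix.mul_assoc]
      have c2 : (B * B.transpose * (B * B.transpose)).trace
          = (B.transpose * B * (B.transpose * B)).trace := by
        rw [Matrix.mul_assoc, Matrix.trace_mul_comm]; simp only [Matrix.mul_assoc]
      have c3 : (B * B.transpose * (B₀ * B₀.transpose)).trace
          = ((B₀.transpose * B).transpose * (B₀.transpose * B)).trace := by
        rw [Matrix.mul_assoc, Matrix.trace_mul_comm]
        simp only [Matrix.mul_assoc, Matrix.transpose_mul, Matrix.transpose_transpose]
      have c4 := Matrix.trace_mul_comm (B₀ * B₀.transpose) (B * B.transpose)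
      simp only [hG, Matrix.sub_mul, Matrix.mul_sub, Matrix.trace_sub]
      linarith
    have t3 : (F * F.transpose).trace = (A₀.transpose * A₀ * (B₀.transpose * B₀)).trace
        - ((A₀.transpose * A).transpose * (B₀.transpose * B)).trace
        - ((B₀.transpose * B).transpose * (A₀.transpose * A)).trace
        + (A.transpose * A * (B.transpose * B)).trace := by
      have c1 : (A₀ * B₀.transpose * (B₀ * A₀.transpose)).trace
          = (A₀.transpose * A₀ * (B₀.transpose * B₀)).trace := by
        rw [← Matrix.mul_assoc, Matrix.trace_mul_comm]; simp only [Matrix.mul_assoc]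
      have c2 : (A * B.transpose * (B * A.transpose)).trace
          = (A.transpose * A * (B.transpose * B)).trace := by
        rw [← Matrix.mul_assoc, Matrix.trace_mul_comm]; simp only [Matrix.mul_assoc]
      have c3 : (A * B.transpose * (B₀ * A₀.transpose)).trace
          = ((B₀.transpose * B).transpose * (A₀.transpose * A)).trace := by
        rw [Matrix.mul_assoc, Matrix.trace_mul_comm]
        simp only [Matrix.mul_assoc, Matrix.transpose_mul, Matrix.transpose_transpose]
      have c4 : (A₀ * B₀.transpose * (B * A.transpose)).trace
          = ((A₀.transpose * A).transpose * (B₀.transpose * B)).trace := by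
        rw [← Matrix.mul_assoc, Matrix.trace_mul_comm]
        simp only [Matrix.mul_assoc, Matrix.transpose_mul, Matrix.transpose_transpose]
      simp only [hF, Matrix.transpose_sub, Matrix.transpose_mul, Matrix.transpose_transpose,
        Matrix.sub_mul, Matrix.mul_sub, Matrix.trace_sub] at c3 c4 ⊢
      linarith
    rw [t1, t2, t3]
    simp only [Matrix.transpose_sub, Matrix.sub_mul, Matrix.mul_sub, Matrix.trace_sub] at hN
    rw [h₀, h]
    linarith
  linarith

/-- Polar decomposition of a square matrix: up to an orthogonal factor it is `K * Kᵀ`. -/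
theorem exists_orthogonal_transpose_mul_eq {r : ℕ} (A : Matrix (Fin r) (Fin r) ℝ) :
    ∃ R K : Matrix (Fin r) (Fin r) ℝ, R * R.transpose = 1 ∧ R.transpose * R = 1 ∧
      R.transpose * A = K * K.transpose := by
  obtain ⟨U, σ, V, h⟩ := exists_isSVD A
  -- The SVD is indexed by `Fin (min r r)`; its data are generalized so that the index type can be
  -- rewritten to `Fin r`, where the factors become square and hence orthogonal.
  have hr : min r r = r := min_self r
  have hU := h.orthonormal_left
  have hV := h.orthonormal_right
  have hA := h.eq_mul
  have hσ := h.nonneg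
  clear h
  revert U σ V
  rw [hr]
  intro U σ V hU hV hA hσ
  have hU' : U * U.transpose = 1 := mul_eq_one_comm.1 hU
  have hV' : V * V.transpose = 1 := mul_eq_one_comm.1 hV
  have e1 : ∀ P Q : Matrix (Fin r) (Fin r) ℝ, P * P.transpose = 1 → Q.transpose * Q = 1 →
      P * Q.transpose * (P * Q.transpose).transpose = 1 := by
    intro P Q hP hQ
    rw [Matrix.transpose_mul, Matrix.transpose_transpose]
    calc P * Q.transpose * (Q * P.transpose) = P * (Q.transpose * Q) * P.transpose := by
          simp only [Matrix.mul_assoc]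
      _ = 1 := by rw [hQ, Matrix.mul_one, hP]
  have hR := e1 U V hU' hV
  refine ⟨U * V.transpose, V * Matrix.diagonal (fun i => Real.sqrt (σ i)), hR,
    mul_eq_one_comm.1 hR, ?_⟩
  rw [hA]
  simp only [Matrix.transpose_mul, Matrix.transpose_transpose, Matrix.diagonal_transpose]
  calc V * U.transpose * (U * Matrix.diagonal σ * V.transpose)
      = V * (U.transpose * U) * Matrix.diagonal σ * V.transpose := by
        simp only [Matrix.mul_assoc]
    _ = V * (Matrix.diagonal (fun i => Real.sqrt (σ i)) * Matrix.diagonal fun i => Real.sqrt (σ i))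
          * V.transpose := by
        rw [hU, Matrix.mul_one, Matrix.diagonal_mul_diagonal]
        simp only [Real.mul_self_sqrt (hσ _)]
    _ = _ := by simp only [Matrix.mul_assoc]

/-- Factors of nearby Gram matrices are close up to an orthogonal transformation. -/
theorem exists_orthogonal_sum_sq_sub_le {m : Type*} [Fintype m] [DecidableEq m] {r : ℕ}
    (Z Y₀ : Matrix m (Fin r) ℝ) {l : ℝ} (hl : ∀ x, l * (x ⬝ᵥ x) ≤ Y₀.mulVec x ⬝ᵥ Y₀.mulVec x) :
    ∃ R : Matrix (Fin r) (Fin r) ℝ, R * R.transpose = 1 ∧ R.transpose * R = 1 ∧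
      4 / 5 * l * ∑ i, ∑ j, (Z - Y₀ * R) i j ^ 2
        ≤ ((Z * Z.transpose - Y₀ * Y₀.transpose) ^ 2).trace := by
  obtain ⟨R, K, hR, hR', hK⟩ := exists_orthogonal_transpose_mul_eq (Y₀.transpose * Z)
  refine ⟨R, hR, hR', ?_⟩
  set Y := Y₀ * R with hY
  set Δ := Z - Y with hΔ
  have hYY : Y₀ * Y₀.transpose = Y * Y.transpose := by
    rw [hY, Matrix.transpose_mul]
    calc _ = Y₀ * (1 : Matrix (Fin r) (Fin r) ℝ) * Y₀.transpose := by rw [Matrix.mul_one]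
      _ = _ := by rw [← hR]; simp only [Matrix.mul_assoc]
  have hYZ : Y.transpose * Z = K * K.transpose := by
    rw [hY, Matrix.transpose_mul, Matrix.mul_assoc, hK]
  have hZY : Z.transpose * Y = K * K.transpose := by
    have := congrArg Matrix.transpose hYZ
    simpa only [Matrix.transpose_mul, Matrix.transpose_transpose] using this
  set S := K * K.transpose with hS
  set G := Z.transpose * Z with hG
  set H := Y.transpose * Y with hH
  have hSs : S.transpose = S := by rw [hS, Matrix.transpose_mul, Matrix.transpose_transpose]
  have hHs : H.transpose = H := by rw [hH, Matrix.transpose_mul, Matrix.transpose_transpose]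
  have hGs : G.transpose = G := by rw [hG, Matrix.transpose_mul, Matrix.transpose_transpose]
  have hL : Δ.transpose * Δ = G - S - S + H := by
    rw [hΔ, Matrix.transpose_sub, Matrix.sub_mul, Matrix.mul_sub, Matrix.mul_sub, hYZ, hZY, ← hG,
      ← hH]
    abel
  have hlhs : ((Z * Z.transpose - Y * Y.transpose) ^ 2).trace
      = (G * G).trace - 2 * (S * S).trace + (H * H).trace := by
    have c1 : (Z * Z.transpose * (Z * Z.transpose)).trace = (G * G).trace := by
      rw [Matrix.mul_assoc, Matrix.trace_mul_comm, hG]; simp only [Matrix.mul_assoc]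
    have c2 : (Y * Y.transpose * (Y * Y.transpose)).trace = (H * H).trace := by
      rw [Matrix.mul_assoc, Matrix.trace_mul_comm, hH]; simp only [Matrix.mul_assoc]
    have c3 : (Z * Z.transpose * (Y * Y.transpose)).trace = (S * S).trace := by
      rw [Matrix.mul_assoc, Matrix.trace_mul_comm]
      calc _ = (Z.transpose * Y * (Y.transpose * Z)).trace := by simp only [Matrix.mul_assoc]
        _ = _ := by rw [hYZ, hZY]
    have c4 := Matrix.trace_mul_comm (Z * Z.transpose) (Y * Y.transpose)
    simp only [pow_two, Matrix.sub_mul, Matrix.mul_sub, Matrix.trace_sub]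
    linarith
  have hLS : 0 ≤ (Δ.transpose * Δ * S).trace := by
    have : (Δ.transpose * Δ * S).trace = ((Δ * K).transpose * (Δ * K)).trace := by
      rw [hS, ← Matrix.mul_assoc, Matrix.trace_mul_comm, Matrix.transpose_mul]
      simp only [Matrix.mul_assoc]
    rw [this]
    exact trace_transpose_mul_self_nonneg _
  have hLH : l * ∑ i, ∑ j, Δ i j ^ 2 ≤ (Δ.transpose * Δ * H).trace := by
    have e1 : (Δ.transpose * Δ * H).trace = ∑ i, Y.mulVec (Δ i) ⬝ᵥ Y.mulVec (Δ i) := by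
      have : (Δ.transpose * Δ * H).trace
          = ((Y * Δ.transpose).transpose * (Y * Δ.transpose)).trace := by
        rw [Matrix.mul_assoc, Matrix.trace_mul_comm, hH, Matrix.transpose_mul Y,
          Matrix.transpose_transpose]
        simp only [Matrix.mul_assoc]
      rw [this]
      rfl
    rw [e1, Finset.mul_sum]
    refine Finset.sum_le_sum fun i _ => ?_
    have h1 := hl (R.mulVec (Δ i))
    rw [mulVec_dotProduct_mulVec_of_orthonormal hR', Matrix.mulVec_mulVec, ← hY] at h1
    simpa only [dotProduct, ← pow_two] using h1
  -- With `L = Δᵀ Δ`, where polar alignment has made `S = Yᵀ Z` positive semidefinite, the constants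
  -- come from the identity `tr G² - 2 tr S² + tr H² - (4/5) tr (L H) = ‖G - (3/5) S - (2/5) H‖² +
  -- (6/5) tr (L S) + (1/25) ‖S - H‖²` in Frobenius norms; every term on its right is nonnegative.
  have hsq1 : 0 ≤ ((G - (3 / 5 : ℝ) • S - (2 / 5 : ℝ) • H)
      * (G - (3 / 5 : ℝ) • S - (2 / 5 : ℝ) • H)).trace := by
    have := trace_mul_transpose_self_nonneg (G - (3 / 5 : ℝ) • S - (2 / 5 : ℝ) • H)
    rwa [Matrix.transpose_sub, Matrix.transpose_sub, Matrix.transpose_smul, Matrix.transpose_smul,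
      hSs, hHs, hGs] at this
  have hsq2 : 0 ≤ ((S - H) * (S - H)).trace := by
    have := trace_mul_transpose_self_nonneg (S - H)
    rwa [Matrix.transpose_sub, hSs, hHs] at this
  have d1 := Matrix.trace_mul_comm G S
  have d2 := Matrix.trace_mul_comm G H
  have d3 := Matrix.trace_mul_comm S H
  rw [hYY, hlhs]
  rw [hL] at hLS hLH
  simp only [Matrix.sub_mul, Matrix.mul_sub, Matrix.add_mul, Matrix.smul_mul, Matrix.mul_smul,
    Matrix.trace_sub, Matrix.trace_add, Matrix.trace_smul, smul_eq_mul] at hLS hLH hsq1 hsq2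
  linarith

end Procrustes

/-! ### Row clipping and elementary norm bounds. -/

section Clipping

theorem frobNorm_sq {m n : Type*} [Fintype m] [Fintype n] (A : Matrix m n ℝ) :
    frobNorm A ^ 2 = ∑ i, ∑ j, A i j ^ 2 :=
  Real.sq_sqrt (Finset.sum_nonneg fun _ _ => Finset.sum_nonneg fun _ _ => sq_nonneg _)

theorem rowNorm_sq {m n : Type*} [Fintype n] (A : Matrix m n ℝ) (i : m) :
    rowNorm A i ^ 2 = ∑ j, A i j ^ 2 :=
  Real.sq_sqrt (Finset.sum_nonneg fun _ _ => sq_nonneg _)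

theorem rowNorm_nonneg {m n : Type*} [Fintype n] (A : Matrix m n ℝ) (i : m) : 0 ≤ rowNorm A i :=
  Real.sqrt_nonneg _

theorem rowNorm_mul_orthogonal {m : Type*} {r : ℕ} (A : Matrix m (Fin r) ℝ)
    {R : Matrix (Fin r) (Fin r) ℝ} (hR : R * R.transpose = 1) (i : m) :
    rowNorm (A * R) i = rowNorm A i := by
  have h := mulVec_dotProduct_mulVec_of_orthonormal (U := R.transpose)
    (by rwa [Matrix.transpose_transpose]) (A i) (A i)
  have e : ∀ j, (A * R) i j = R.transpose.mulVec (A i) j := fun j => by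
    rw [Matrix.mulVec_transpose]; rfl
  simp only [rowNorm, e]
  simp only [dotProduct, ← pow_two] at h
  rw [h]

/-- Radial projection onto a ball does not increase the distance to points of the ball. -/
theorem sum_sq_clip_sub_le {ι : Type*} [Fintype ι] (z w : ι → ℝ) {N ρ : ℝ} (hρ : 0 ≤ ρ)
    (hN : ρ < N) (hz : ∑ j, z j ^ 2 = N ^ 2) (hw : ∑ j, w j ^ 2 ≤ ρ ^ 2) :
    ∑ j, (z j / N * ρ - w j) ^ 2 ≤ ∑ j, (z j - w j) ^ 2 := by
  have hN0 : 0 < N := hρ.trans_lt hN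
  set a := ρ / N with ha
  have ha0 : 0 ≤ a := by positivity
  have ha1 : a < 1 := (div_lt_one hN0).2 hN
  have haN : a * N = ρ := div_mul_cancel₀ _ hN0.ne'
  have hcs : ∑ j, z j * w j ≤ a * N ^ 2 := by
    have h := Finset.sum_mul_sq_le_sq_mul_sq Finset.univ z w
    have h2 : (∑ j, z j * w j) ^ 2 ≤ (N * ρ) ^ 2 := by
      rw [mul_pow]
      refine h.trans ?_
      rw [hz]
      gcongr
    have := abs_le_of_sq_le_sq h2 (by positivity)
    rw [← haN] at this
    linarith [le_abs_self (∑ j, z j * w j)]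
  have e1 : ∑ j, (z j / N * ρ - w j) ^ 2
      = a ^ 2 * ∑ j, z j ^ 2 - 2 * a * ∑ j, z j * w j + ∑ j, w j ^ 2 := by
    rw [Finset.mul_sum, Finset.mul_sum, ← Finset.sum_sub_distrib, ← Finset.sum_add_distrib]
    refine Finset.sum_congr rfl fun j _ => ?_
    rw [ha]
    ring
  have e2 : ∑ j, (z j - w j) ^ 2
      = ∑ j, z j ^ 2 - 2 * ∑ j, z j * w j + ∑ j, w j ^ 2 := by
    rw [Finset.mul_sum, ← Finset.sum_sub_distrib, ← Finset.sum_add_distrib]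
    exact Finset.sum_congr rfl fun j _ => by ring
  rw [e1, e2, hz]
  set q := ∑ j, z j * w j
  -- This product is the difference of the two sides; Cauchy–Schwarz gave `q ≤ a N²`, and `a < 1`.
  have h1 : 0 ≤ (1 - a) * ((1 + a) * N ^ 2 - 2 * q) := by
    have : 0 ≤ (1 - a) * N ^ 2 := mul_nonneg (by linarith) (sq_nonneg _)
    exact mul_nonneg (by linarith) (by linarith)
  linarith

theorem frobNorm_clipRows_sub_le {m : Type*} [Fintype m] {r : ℕ} {ρ : ℝ} (hρ : 0 ≤ ρ)
    (Z Y : Matrix m (Fin r) ℝ) (hY : ∀ i, rowNorm Y i ≤ ρ) :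
    frobNorm (clipRows ρ Z - Y) ≤ frobNorm (Z - Y) := by
  refine Real.sqrt_le_sqrt (Finset.sum_le_sum fun i _ => ?_)
  simp only [Matrix.sub_apply, clipRows, Matrix.of_apply]
  split_ifs with h
  · rfl
  · exact sum_sq_clip_sub_le (Z i) (Y i) hρ (not_le.1 h) (rowNorm_sq Z i).symm
      ((rowNorm_sq Y i).symm.trans_le (pow_le_pow_left₀ (rowNorm_nonneg Y i) (hY i) 2))

theorem bddBelow_range_frobNorm {m : Type*} [Fintype m] {r : ℕ} (Z Zs : Matrix m (Fin r) ℝ) :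
    BddBelow (Set.range fun R : Matrix.orthogonalGroup (Fin r) ℝ =>
      frobNorm (Z - Zs * (R : Matrix (Fin r) (Fin r) ℝ))) :=
  ⟨0, by rintro _ ⟨R, rfl⟩; exact Real.sqrt_nonneg _⟩

theorem factorDist_le {m : Type*} [Fintype m] {r : ℕ} (Z Zs : Matrix m (Fin r) ℝ)
    {R : Matrix (Fin r) (Fin r) ℝ} (hR : R * R.transpose = 1) :
    factorDist Z Zs ≤ frobNorm (Z - Zs * R) :=
  ciInf_le (bddBelow_range_frobNorm Z Zs)
    (⟨R, (Matrix.mem_orthogonalGroup_iff (Fin r) ℝ).2 hR⟩ : Matrix.orthogonalGroup (Fin r) ℝ)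

/-- Rotation preserves row norms, so the rows of every competitor `Zs * R` lie in the clipping ball;
the comparison holds for each `R` and therefore for the infimum. -/
theorem factorDist_clipRows_le {m : Type*} [Fintype m] {r : ℕ} {ρ : ℝ} (hρ : 0 ≤ ρ)
    (Z Zs : Matrix m (Fin r) ℝ) (hZs : ∀ i, rowNorm Zs i ≤ ρ) :
    factorDist (clipRows ρ Z) Zs ≤ factorDist Z Zs := by
  refine ciInf_mono (bddBelow_range_frobNorm _ _) fun R =>
    frobNorm_clipRows_sub_le hρ _ _ fun i => ?_
  rw [rowNorm_mul_orthogonal _ ((Matrix.mem_orthogonalGroup_iff (Fin r) ℝ).1 R.2)]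
  exact hZs i

theorem mulVec_dotProduct_le_opNorm_sq {m n : Type*} [Fintype m] [Fintype n] [DecidableEq n]
    (A : Matrix m n ℝ) (x : n → ℝ) :
    A.mulVec x ⬝ᵥ A.mulVec x ≤ opNorm A ^ 2 * (x ⬝ᵥ x) := by
  have h := (LinearMap.toContinuousLinearMap (Matrix.toEuclideanLin A)).le_opNorm (WithLp.toLp 2 x)
  have h2 := pow_le_pow_left₀ (norm_nonneg _) h 2
  rw [mul_pow, EuclideanSpace.norm_sq_eq, EuclideanSpace.norm_sq_eq] at h2
  simpa [dotProduct, ← pow_two, opNorm] using h2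

theorem opNorm_nonneg {m n : Type*} [Fintype m] [Fintype n] [DecidableEq n] (A : Matrix m n ℝ) :
    0 ≤ opNorm A := norm_nonneg _

theorem mulVec_dotProduct_le_sum_sq {m n : Type*} [Fintype m] [Fintype n] (A : Matrix m n ℝ)
    (x : n → ℝ) : A.mulVec x ⬝ᵥ A.mulVec x ≤ (∑ i, ∑ j, A i j ^ 2) * (x ⬝ᵥ x) := by
  rw [dotProduct, Finset.sum_mul]
  refine Finset.sum_le_sum fun i _ => ?_
  have := Finset.sum_mul_sq_le_sq_mul_sq Finset.univ (A i) x
  simpa [Matrix.mulVec, dotProduct, ← pow_two] using this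

end Clipping

/-! ### Gram matrix, spectrum and row norms of the lifted factor. -/

section LiftedFactor

variable {n₁ n₂ r : ℕ} {U : Matrix (Fin n₁) (Fin r) ℝ} {σ : Fin r → ℝ}
  {V : Matrix (Fin n₂) (Fin r) ℝ}

theorem liftedFactor_eq_fromRows (U : Matrix (Fin n₁) (Fin r) ℝ) (σ : Fin r → ℝ)
    (V : Matrix (Fin n₂) (Fin r) ℝ) :
    liftedFactor U σ V = Matrix.fromRows (U * Matrix.diagonal fun j => Real.sqrt (σ j))
      (V * Matrix.diagonal fun j => Real.sqrt (σ j)) := by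
  rw [liftedFactor, Matrix.fromRows_mul]

theorem mul_diagonal_sqrt_gram {m : Type*} [Fintype m] {Q : Matrix m (Fin r) ℝ}
    (hQ : Q.transpose * Q = 1) (hσ : ∀ j, 0 ≤ σ j) :
    (Q * Matrix.diagonal fun j => Real.sqrt (σ j)).transpose
      * (Q * Matrix.diagonal fun j => Real.sqrt (σ j)) = Matrix.diagonal σ := by
  rw [Matrix.transpose_mul, Matrix.diagonal_transpose]
  calc _ = (Matrix.diagonal fun j => Real.sqrt (σ j)) * (Q.transpose * Q)
          * Matrix.diagonal fun j => Real.sqrt (σ j) := by simp only [Matrix.mul_assoc]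
    _ = _ := by
      rw [hQ, Matrix.mul_one, Matrix.diagonal_mul_diagonal]
      simp only [Real.mul_self_sqrt (hσ _)]

theorem mul_diagonal_sqrt_mul_transpose {m n : Type*} [Fintype m] [Fintype n]
    (P : Matrix m (Fin r) ℝ) (Q : Matrix n (Fin r) ℝ) (hσ : ∀ j, 0 ≤ σ j) :
    (P * Matrix.diagonal fun j => Real.sqrt (σ j))
      * (Q * Matrix.diagonal fun j => Real.sqrt (σ j)).transpose
      = P * Matrix.diagonal σ * Q.transpose := by
  rw [Matrix.transpose_mul, Matrix.diagonal_transpose]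
  calc _ = P * ((Matrix.diagonal fun j => Real.sqrt (σ j))
          * Matrix.diagonal fun j => Real.sqrt (σ j)) * Q.transpose := by
        simp only [Matrix.mul_assoc]
    _ = _ := by
      rw [Matrix.diagonal_mul_diagonal]
      simp only [Real.mul_self_sqrt (hσ _)]

/-- The two blocks contribute equally. Hence the squared singular values of the lifted factor are `2
σ j`, the source of the factors `2 σ_r` and `2 σ_1` below. -/
theorem liftedFactor_mulVec_dotProduct (hU : U.transpose * U = 1) (hV : V.transpose * V = 1)
    (hσ : ∀ j, 0 ≤ σ j) (x : Fin r → ℝ) :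
    (liftedFactor U σ V).mulVec x ⬝ᵥ (liftedFactor U σ V).mulVec x = 2 * ∑ j, σ j * x j ^ 2 := by
  have h : ∀ {n : ℕ} (Q : Matrix (Fin n) (Fin r) ℝ), Q.transpose * Q = 1 →
      (Q * Matrix.diagonal fun j => Real.sqrt (σ j)).mulVec x
        ⬝ᵥ (Q * Matrix.diagonal fun j => Real.sqrt (σ j)).mulVec x = ∑ j, σ j * x j ^ 2 := by
    intro n Q hQ
    rw [← Matrix.mulVec_mulVec, mulVec_dotProduct_mulVec_of_orthonormal hQ]
    simp only [dotProduct, Matrix.mulVec_diagonal]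
    refine Finset.sum_congr rfl fun j _ => ?_
    calc _ = Real.sqrt (σ j) * Real.sqrt (σ j) * x j ^ 2 := by ring
      _ = _ := by rw [Real.mul_self_sqrt (hσ j)]
  rw [liftedFactor_eq_fromRows, Matrix.fromRows_mulVec, sumElim_dotProduct_sumElim, h U hU,
    h V hV, two_mul]

theorem rowNorm_mul_diagonal_sqrt_le {m : Type*} (Q : Matrix m (Fin r) ℝ) (hσ : ∀ j, 0 ≤ σ j)
    {S : ℝ} (hS : ∀ j, σ j ≤ S) (i : m) :
    rowNorm (Q * Matrix.diagonal fun j => Real.sqrt (σ j)) i ^ 2 ≤ S * rowNorm Q i ^ 2 := by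
  rw [rowNorm_sq, rowNorm_sq, Finset.mul_sum]
  refine Finset.sum_le_sum fun j _ => ?_
  rw [Matrix.mul_diagonal, mul_pow, Real.sq_sqrt (hσ j), mul_comm]
  exact mul_le_mul_of_nonneg_right (hS j) (sq_nonneg _)

end LiftedFactor

/-! ### Consequences of incoherence, and the two halves of the analysis. -/

section SpectralInitialization

variable {n₁ n₂ r : ℕ} {X M : Matrix (Fin n₁) (Fin n₂) ℝ} {U U₀ : Matrix (Fin n₁) (Fin r) ℝ}
  {σ σ₀ : Fin r → ℝ} {V V₀ : Matrix (Fin n₂) (Fin r) ℝ} {μ : ℝ}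

theorem transpose_mul_self_castLE {n k : ℕ} {Q : Matrix (Fin n) (Fin k) ℝ}
    (hQ : Q.transpose * Q = 1) (h : r ≤ k) {P : Matrix (Fin n) (Fin r) ℝ}
    (hP : ∀ i j, P i j = Q i (Fin.castLE h j)) : P.transpose * P = 1 := by
  have e : P = Q.submatrix id (Fin.castLE h) := by ext i j; exact hP i j
  have h1 : (Q.transpose * Q).submatrix (Fin.castLE h) (Fin.castLE h) = 1 := by
    rw [hQ, Matrix.submatrix_one _ (Fin.castLE_injective h)]
  rw [e, ← h1]
  rfl

theorem IsTruncatedSVD.orthonormal_left (h : IsTruncatedSVD M U₀ σ₀ V₀) :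
    U₀.transpose * U₀ = 1 := by
  obtain ⟨U', σ', V', hr, h', hU, hσ, hV⟩ := h
  exact transpose_mul_self_castLE h'.orthonormal_left hr hU

theorem IsTruncatedSVD.orthonormal_right (h : IsTruncatedSVD M U₀ σ₀ V₀) :
    V₀.transpose * V₀ = 1 := by
  obtain ⟨U', σ', V', hr, h', hU, hσ, hV⟩ := h
  exact transpose_mul_self_castLE h'.orthonormal_right hr hV

theorem IsTruncatedSVD.nonneg (h : IsTruncatedSVD M U₀ σ₀ V₀) (j : Fin r) : 0 ≤ σ₀ j := by
  obtain ⟨U', σ', V', hr, h', hU, hσ, hV⟩ := h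
  rw [hσ]
  exact h'.nonneg _

theorem IsSVD.sigma_last_pos (hX : IsSVD X U σ V) (hrank : X.rank = r) (hr : 0 < r) :
    0 < σ ⟨r - 1, Nat.sub_one_lt_of_lt hr⟩ := by
  refine lt_of_le_of_ne (hX.nonneg _) fun h0 => ?_
  have h1 : X.rank ≤ (Matrix.diagonal σ).rank := by
    rw [hX.eq_mul]
    exact (Matrix.rank_mul_le_left _ _).trans (Matrix.rank_mul_le_right _ _)
  rw [hrank, Matrix.rank_diagonal] at h1
  have h2 : Fintype.card {i // σ i ≠ 0} < Fintype.card (Fin r) :=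
    Fintype.card_subtype_lt (x := ⟨r - 1, Nat.sub_one_lt_of_lt hr⟩) (by simp [← h0])
  rw [Fintype.card_fin] at h2
  omega

theorem sum_rowNorm_sq {m : Type*} [Fintype m] {Q : Matrix m (Fin r) ℝ}
    (hQ : Q.transpose * Q = 1) : ∑ i, rowNorm Q i ^ 2 = r := by
  simp only [rowNorm_sq]
  rw [sum_sq_eq_trace, Matrix.trace_mul_comm, hQ, Matrix.trace_one, Fintype.card_fin]

/-- For negative `μ` the real square root takes its default value `0`, so all rows of `U` would
vanish, whereas their squared norms sum to `r`. -/
theorem IsIncoherent.nonneg (h : IsIncoherent μ U V) (hU : U.transpose * U = 1) (hr : 0 < r) :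
    0 ≤ μ := by
  by_contra hμ
  have h0 : ∀ i, rowNorm U i ^ 2 = 0 := by
    intro i
    have h1 := h.1 i
    rw [Real.sqrt_eq_zero_of_nonpos (div_nonpos_of_nonpos_of_nonneg
      (mul_nonpos_of_nonpos_of_nonneg (not_le.1 hμ).le (Nat.cast_nonneg r)) (Nat.cast_nonneg _))]
      at h1
    rw [le_antisymm h1 (rowNorm_nonneg U i)]
    simp
  have := sum_rowNorm_sq hU
  simp only [h0, Finset.sum_const_zero] at this
  have : (0 : ℝ) < r := by exact_mod_cast hr
  linarith

theorem IsIncoherent.rowNorm_left_sq_le (h : IsIncoherent μ U V) (hμ : 0 ≤ μ)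
    (hmin : 0 < min n₁ n₂) (i : Fin n₁) :
    rowNorm U i ^ 2 ≤ μ * r / (min n₁ n₂ : ℕ) := by
  have h1 := pow_le_pow_left₀ (rowNorm_nonneg U i) (h.1 i) 2
  rw [Real.sq_sqrt (by positivity)] at h1
  refine h1.trans ?_
  have : (0 : ℝ) < (min n₁ n₂ : ℕ) := by exact_mod_cast hmin
  gcongr
  exact min_le_left _ _

theorem IsIncoherent.rowNorm_right_sq_le (h : IsIncoherent μ U V) (hμ : 0 ≤ μ)
    (hmin : 0 < min n₁ n₂) (i : Fin n₂) :
    rowNorm V i ^ 2 ≤ μ * r / (min n₁ n₂ : ℕ) := by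
  have h1 := pow_le_pow_left₀ (rowNorm_nonneg V i) (h.2 i) 2
  rw [Real.sq_sqrt (by positivity)] at h1
  refine h1.trans ?_
  have : (0 : ℝ) < (min n₁ n₂ : ℕ) := by exact_mod_cast hmin
  gcongr
  exact min_le_right _ _

/-- Splitting `σ` evenly as `√σ √σ` makes each entry an inner product of two scaled rows, to which
Cauchy–Schwarz applies. -/
theorem abs_mul_diagonal_mul_transpose_le {m n : Type*} [Fintype m] [Fintype n]
    (P : Matrix m (Fin r) ℝ) (Q : Matrix n (Fin r) ℝ) (hσ : ∀ j, 0 ≤ σ j) {S t : ℝ}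
    (hS : ∀ j, σ j ≤ S) (hS0 : 0 ≤ S) (ht : 0 ≤ t) (hP : ∀ i, rowNorm P i ^ 2 ≤ t)
    (hQ : ∀ j, rowNorm Q j ^ 2 ≤ t) (i : m) (j : n) :
    |(P * Matrix.diagonal σ * Q.transpose) i j| ≤ S * t := by
  rw [← mul_diagonal_sqrt_mul_transpose P Q hσ]
  set A := P * Matrix.diagonal fun j => Real.sqrt (σ j)
  set B := Q * Matrix.diagonal fun j => Real.sqrt (σ j)
  have hA : rowNorm A i ^ 2 ≤ S * t := (rowNorm_mul_diagonal_sqrt_le P hσ hS i).trans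
    (mul_le_mul_of_nonneg_left (hP i) hS0)
  have hB : rowNorm B j ^ 2 ≤ S * t := (rowNorm_mul_diagonal_sqrt_le Q hσ hS j).trans
    (mul_le_mul_of_nonneg_left (hQ j) hS0)
  refine abs_le_of_sq_le_sq ?_ (mul_nonneg hS0 ht)
  have h := Finset.sum_mul_sq_le_sq_mul_sq Finset.univ (A i) (B j)
  rw [rowNorm_sq] at hA hB
  calc _ = (∑ k, A i k * B j k) ^ 2 := by
        rw [Matrix.mul_apply]
        simp only [Matrix.transpose_apply]
    _ ≤ _ := h
    _ ≤ (S * t) * (S * t) := mul_le_mul hA hB (Finset.sum_nonneg fun _ _ => sq_nonneg _)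
        (mul_nonneg hS0 ht)
    _ = _ := by ring

theorem sum_sq_mul_diagonal_mul_transpose_le {m n : Type*} [Fintype m] [Fintype n]
    (P : Matrix m (Fin r) ℝ) {Q : Matrix n (Fin r) ℝ} (hQ : Q.transpose * Q = 1)
    (hσ : ∀ j, 0 ≤ σ j) {S : ℝ} (hS : ∀ j, σ j ≤ S) (i : m) :
    ∑ j, (P * Matrix.diagonal σ * Q.transpose) i j ^ 2 ≤ S ^ 2 * rowNorm P i ^ 2 := by
  have h := mulVec_dotProduct_mulVec_of_orthonormal hQ (fun k => P i k * σ k) fun k => P i k * σ k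
  have e : ∀ j, (P * Matrix.diagonal σ * Q.transpose) i j
      = Q.mulVec (fun k => P i k * σ k) j := by
    intro j
    rw [Matrix.mul_apply]
    simp only [Matrix.mul_diagonal, Matrix.transpose_apply, Matrix.mulVec, dotProduct]
    exact Finset.sum_congr rfl fun k _ => mul_comm _ _
  simp only [e]
  simp only [dotProduct, ← pow_two] at h
  rw [h, rowNorm_sq, Finset.mul_sum]
  refine Finset.sum_le_sum fun k _ => ?_
  rw [mul_pow, mul_comm]
  exact mul_le_mul_of_nonneg_right (pow_le_pow_left₀ (hσ k) (hS k) 2) (sq_nonneg _)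

/-- A bilinear bound for `W` gives an operator norm bound. -/
theorem mulVec_dotProduct_le_of_bilinear {m n : Type*} [Fintype m] [Fintype n] (W : Matrix m n ℝ)
    {s : ℝ} (hs : 0 < s)
    (h : ∀ u v, 2 * (u ⬝ᵥ W.mulVec v) ≤ s * (u ⬝ᵥ u + v ⬝ᵥ v)) (y : n → ℝ) :
    W.mulVec y ⬝ᵥ W.mulVec y ≤ s ^ 2 * (y ⬝ᵥ y) := by
  -- The factor `s⁻¹` balances the two terms on the right of `h`.
  have h1 := h (s⁻¹ • W.mulVec y) y
  simp only [smul_dotProduct, dotProduct_smul, smul_eq_mul] at h1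
  set a := W.mulVec y ⬝ᵥ W.mulVec y
  have h2 := mul_le_mul_of_nonneg_left h1 hs.le
  have e1 : s * (2 * (s⁻¹ * a)) = 2 * a := by field_simp
  have e2 : s * (s * (s⁻¹ * (s⁻¹ * a) + y ⬝ᵥ y)) = a + s ^ 2 * (y ⬝ᵥ y) := by field_simp
  linarith

/-- Deterministic part of the analysis of spectral initialization: it succeeds as soon as the
operator norm of the perturbation `M - X` is at most `σ_r / (20 √r)`. -/
theorem factorDist_liftedFactor_le (hr : 0 < r) (hX : IsSVD X U σ V) (hrank : X.rank = r)
    (hinc : IsIncoherent μ U V) (h₀ : IsTruncatedSVD M U₀ σ₀ V₀) {s : ℝ} (hs : 0 ≤ s)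
    (hs2 : 400 * r * s ^ 2 ≤ σ ⟨r - 1, Nat.sub_one_lt_of_lt hr⟩ ^ 2)
    (hW : ∀ y, (M - X).mulVec y ⬝ᵥ (M - X).mulVec y ≤ s ^ 2 * (y ⬝ᵥ y)) :
    factorDist (clipRows (clipRadius μ (liftedFactor U₀ σ₀ V₀)) (liftedFactor U₀ σ₀ V₀))
        (liftedFactor U σ V) ≤ factorDist (liftedFactor U₀ σ₀ V₀) (liftedFactor U σ V) ∧
      factorDist (liftedFactor U₀ σ₀ V₀) (liftedFactor U σ V)
        ≤ 1 / 4 * Real.sqrt (σ ⟨r - 1, Nat.sub_one_lt_of_lt hr⟩) := by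
  set Z₀ := liftedFactor U₀ σ₀ V₀ with hZ₀
  set Zs := liftedFactor U σ V with hZs
  set a := σ ⟨r - 1, Nat.sub_one_lt_of_lt hr⟩ with ha
  set S := σ ⟨0, hr⟩ with hS
  have ha0 : 0 < a := hX.sigma_last_pos hrank hr
  have hleS : ∀ j, σ j ≤ S := fun j => hX.antitone (by rw [Fin.le_def]; exact Nat.zero_le _)
  have hgea : ∀ j, a ≤ σ j := fun j => hX.antitone (by rw [Fin.le_def]; have := j.2; simp; omega)
  have hSa : a ≤ S := hgea _
  have hS0 : 0 ≤ S := ha0.le.trans hSa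
  have hμ : 0 ≤ μ := hinc.nonneg hX.orthonormal_left hr
  have hmin : 0 < min n₁ n₂ := by
    obtain ⟨_, _, _, h, _⟩ := h₀
    omega
  have hfro := h₀.sum_sq_sub_le hX.eq_mul hs hW
  have hgram := trace_gram_sub_sq_le
    ((mul_diagonal_sqrt_gram h₀.orthonormal_left h₀.nonneg).trans
      (mul_diagonal_sqrt_gram h₀.orthonormal_right h₀.nonneg).symm)
    ((mul_diagonal_sqrt_gram hX.orthonormal_left hX.nonneg).trans
      (mul_diagonal_sqrt_gram hX.orthonormal_right hX.nonneg).symm)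
  rw [mul_diagonal_sqrt_mul_transpose U₀ V₀ h₀.nonneg, mul_diagonal_sqrt_mul_transpose U V hX.nonneg,
    ← hX.eq_mul, ← liftedFactor_eq_fromRows, ← liftedFactor_eq_fromRows, ← hZ₀, ← hZs] at hgram
  have hquad := liftedFactor_mulVec_dotProduct hX.orthonormal_left hX.orthonormal_right hX.nonneg
  rw [← hZs] at hquad
  obtain ⟨R, hR, hR', hRd⟩ := exists_orthogonal_sum_sq_sub_le Z₀ Zs (l := 2 * a) fun x => by
    rw [hquad, mul_assoc]
    simp only [dotProduct, Finset.mul_sum, ← pow_two]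
    gcongr
    exact hgea _
  set E := ∑ i, ∑ j, (Z₀ - Zs * R) i j ^ 2 with hE
  -- Chaining the bounds, `(8/5) a E ≤ 4 · 8 r s² ≤ (32/400) a²`, so `E ≤ a / 20`; the target `(√a /
  -- 4)²` is `a / 16`.
  have hEa : E ≤ a / 16 := by
    have h1 : 4 / 5 * (2 * a) * E ≤ 32 / 400 * a ^ 2 := by linarith
    have h2 : a * E ≤ a * (a / 20) := by nlinarith
    have h3 := le_of_mul_le_mul_left h2 ha0
    linarith
  constructor
  · have hρ : 0 ≤ clipRadius μ Z₀ := mul_nonneg (Real.sqrt_nonneg _) (opNorm_nonneg _)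
    refine factorDist_clipRows_le hρ _ _ fun i => ?_
    refine le_of_sq_le_sq ?_ hρ
    -- Test `Z₀` on the rotated top direction: `2 S = |Zs e|² ≤ 2 ‖Z₀‖² + 2 E`, and `E ≤ a / 16 ≤ S
    -- / 16`. The loss of a factor `2` is what the `2` in the clipping radius pays for.
    have hop : S / 2 ≤ opNorm Z₀ ^ 2 := by
      set e : Fin r → ℝ := Pi.single ⟨0, hr⟩ 1 with he
      set y := R.transpose.mulVec e with hy
      have hyy : y ⬝ᵥ y = 1 := by
        rw [hy, mulVec_dotProduct_mulVec_of_orthonormal (by rwa [Matrix.transpose_transpose])]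
        simp [he]
      have h1 := mulVec_dotProduct_le_opNorm_sq Z₀ y
      have h2 := mulVec_dotProduct_le_sum_sq (Z₀ - Zs * R) y
      have h3 : Zs.mulVec e = Z₀.mulVec y - (Z₀ - Zs * R).mulVec y := by
        rw [Matrix.sub_mulVec, hy, Matrix.mulVec_mulVec (N := R.transpose) (M := Zs * R),
          Matrix.mul_assoc, hR, Matrix.mul_one]
        abel
      have h4 : Zs.mulVec e ⬝ᵥ Zs.mulVec e = 2 * S := by
        rw [hquad]
        simp [he, Pi.single_apply, hS]
      rw [hyy, mul_one] at h1 h2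
      rw [h3] at h4
      have h5 := dotProduct_self_nonneg (Z₀.mulVec y + (Z₀ - Zs * R).mulVec y)
      generalize (Z₀ - Zs * R).mulVec y = w at *
      simp only [sub_dotProduct, dotProduct_sub, add_dotProduct, dotProduct_add] at h4 h5
      rw [← hE] at h2
      linarith
    have hrow : rowNorm Zs i ^ 2 ≤ S * (μ * r / (min n₁ n₂ : ℕ)) := by
      rw [hZs, liftedFactor_eq_fromRows]
      rcases i with i | i
      · exact (rowNorm_mul_diagonal_sqrt_le U hX.nonneg hleS i).trans
          (mul_le_mul_of_nonneg_left (hinc.rowNorm_left_sq_le hμ hmin i) hS0)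
      · exact (rowNorm_mul_diagonal_sqrt_le V hX.nonneg hleS i).trans
          (mul_le_mul_of_nonneg_left (hinc.rowNorm_right_sq_le hμ hmin i) hS0)
    rw [clipRadius, mul_pow, Real.sq_sqrt (by positivity)]
    calc _ ≤ S * (μ * r / (min n₁ n₂ : ℕ)) := hrow
      _ = 2 * μ * r / (min n₁ n₂ : ℕ) * (S / 2) := by ring
      _ ≤ _ := by gcongr
  · refine (factorDist_le Z₀ Zs hR).trans (le_of_sq_le_sq ?_ (by positivity))
    rw [frobNorm_sq, mul_pow, Real.sq_sqrt ha0.le]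
    linarith

/-- With high probability the rescaled sampled matrix is within `σ_r / (20 √r)` of `X` in operator
norm. -/
theorem setBernoulli_real_sampling_le (hr : 0 < r) (hX : IsSVD X U σ V) (hrank : X.rank = r)
    (hinc : IsIncoherent μ U V) (p : unitInterval) (hp : 0 < (p : ℝ)) (hn : 1 < max n₁ n₂)
    (hpc : 7200 * μ * (r : ℝ) ^ 2 * (σ ⟨0, hr⟩ / σ ⟨r - 1, Nat.sub_one_lt_of_lt hr⟩) ^ 2
        * Real.log (max n₁ n₂ : ℕ) / (min n₁ n₂ : ℕ) ≤ (p : ℝ)) :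
    (setBernoulli (Set.univ : Set (Fin n₁ × Fin n₂)) p).real
      {Ω | ¬ ∀ u v, 2 * (u ⬝ᵥ ((p : ℝ)⁻¹ • sampleProj Ω X - X).mulVec v) ≤
        σ ⟨r - 1, Nat.sub_one_lt_of_lt hr⟩ / (20 * Real.sqrt r) * (u ⬝ᵥ u + v ⬝ᵥ v)}
      ≤ 2 * ((max n₁ n₂ : ℕ) : ℝ) ^ (-1 : ℝ) := by
  set a := σ ⟨r - 1, Nat.sub_one_lt_of_lt hr⟩ with ha
  set S := σ ⟨0, hr⟩ with hS
  have ha0 : 0 < a := hX.sigma_last_pos hrank hr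
  have hleS : ∀ j, σ j ≤ S := fun j => hX.antitone (by rw [Fin.le_def]; exact Nat.zero_le _)
  have hSa : a ≤ S := hleS _
  have hS0 : 0 < S := ha0.trans_le hSa
  have hμ : 0 ≤ μ := hinc.nonneg hX.orthonormal_left hr
  have hmin : 0 < min n₁ n₂ := by
    have h1 := X.rank_le_width
    have h2 := X.rank_le_height
    omega
  set m : ℝ := ((min n₁ n₂ : ℕ) : ℝ) with hm
  set n : ℝ := ((max n₁ n₂ : ℕ) : ℝ) with hn'
  have hm0 : 0 < m := by rw [hm]; exact_mod_cast hmin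
  have hn1 : 1 < n := by rw [hn']; exact_mod_cast hn
  set L := Real.log n with hL
  have hL0 : 0 < L := Real.log_pos hn1
  set ρ := Real.sqrt r with hρ
  have hr1 : (1 : ℝ) ≤ r := by exact_mod_cast hr
  have hρ2 : ρ ^ 2 = r := Real.sq_sqrt (by positivity)
  have hρ1 : 1 ≤ ρ := Real.one_le_sqrt.2 hr1
  set t := μ * r / m with ht
  have ht0 : 0 ≤ t := by positivity
  -- Chosen so that `θ s = 3 L` for `s = a / (20 ρ)`. The variance term is then `L` times `7200 t r
  -- κ² L / p`, hence at most `L`, which fixes the constant `7200`.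
  set θ := 60 * L * ρ / a with hθ
  set κ := S / a with hκ
  have hκ1 : 1 ≤ κ := (one_le_div ha0).2 hSa
  have hpc' : 7200 * (t * r * κ ^ 2 * L) ≤ p := by
    refine le_trans (le_of_eq ?_) hpc
    rw [ht]
    ring
  have hentry : ∀ i j, θ * |X i j| ≤ p / 2 := by
    intro i j
    have h1 := abs_mul_diagonal_mul_transpose_le U V hX.nonneg hleS hS0.le ht0
      (hinc.rowNorm_left_sq_le hμ hmin) (hinc.rowNorm_right_sq_le hμ hmin) i j
    rw [← hX.eq_mul] at h1
    have h2 : ρ * κ ≤ r * κ ^ 2 := by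
      rw [← hρ2]
      have : ρ * κ * 1 ≤ ρ * κ * (ρ * κ) := by
        gcongr
        nlinarith
      linarith
    calc θ * |X i j| ≤ θ * (S * t) := by gcongr
      _ = 60 * (t * L) * (ρ * κ) := by rw [hθ, hκ]; ring
      _ ≤ 60 * (t * L) * (r * κ ^ 2) := by gcongr
      _ ≤ 3600 * (t * r * κ ^ 2 * L) := by
        have : 0 ≤ t * r * κ ^ 2 * L := by positivity
        linarith
      _ ≤ _ := by linarith
  have hrow : ∀ i, ∑ j, X i j ^ 2 ≤ S ^ 2 * t := by
    intro i
    have h1 := sum_sq_mul_diagonal_mul_transpose_le U hX.orthonormal_right hX.nonneg hleS i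
    rw [← hX.eq_mul] at h1
    exact h1.trans (mul_le_mul_of_nonneg_left (hinc.rowNorm_left_sq_le hμ hmin i) (sq_nonneg _))
  have hcol : ∀ j, ∑ i, X i j ^ 2 ≤ S ^ 2 * t := by
    intro j
    have h1 := sum_sq_mul_diagonal_mul_transpose_le V hX.orthonormal_left hX.nonneg hleS j
    have e : V * Matrix.diagonal σ * U.transpose = X.transpose := by
      rw [hX.eq_mul]
      simp only [Matrix.transpose_mul, Matrix.transpose_transpose, Matrix.diagonal_transpose,
        Matrix.mul_assoc]
    rw [e] at h1
    exact h1.trans (mul_le_mul_of_nonneg_left (hinc.rowNorm_right_sq_le hμ hmin j) (sq_nonneg _))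
  have : Nonempty (Fin n₁ ⊕ Fin n₂) := ⟨Sum.inl ⟨0, by omega⟩⟩
  refine (setBernoulli_real_not_le X p hp (a / (20 * ρ)) (by positivity) hentry hrow hcol).trans ?_
  -- A net exponent of `-2 L` contributes `n⁻²`, against a dimension factor of at most `2 n`.
  have hexp : 2 * θ ^ 2 * (S ^ 2 * t) / p - θ * (a / (20 * ρ)) ≤ -(2 * L) := by
    have e1 : θ * (a / (20 * ρ)) = 3 * L := by
      rw [hθ]
      have : ρ ≠ 0 := by positivity
      field_simp
      norm_num
    have e2 : 2 * θ ^ 2 * (S ^ 2 * t) = L * (7200 * (t * r * κ ^ 2 * L)) := by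
      rw [hθ, hκ, ← hρ2]
      field_simp
      ring
    have e3 : 2 * θ ^ 2 * (S ^ 2 * t) / p ≤ L := by
      rw [div_le_iff₀ hp, e2]
      gcongr
    linarith
  have hn0 : 0 < n := by linarith
  have hsum : (n₁ : ℝ) + n₂ ≤ 2 * n := by
    have h1 : (n₁ : ℝ) ≤ n := by rw [hn']; exact_mod_cast le_max_left _ _
    have h2 : (n₂ : ℝ) ≤ n := by rw [hn']; exact_mod_cast le_max_right _ _
    linarith
  calc _ ≤ 2 * n * Real.exp (-(2 * L)) := by gcongr
    _ = 2 * n ^ (-1 : ℝ) := by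
      rw [Real.rpow_neg_one, Real.exp_neg, two_mul L, Real.exp_add, hL, Real.exp_log hn0]
      field_simp

end SpectralInitialization

end MatrixCompletion

/-! ### Universal constants and assembly. -/

theorem mainTheorem4 :
    ∃ c c₁ c₂ : ℝ, 0 < c ∧ 0 < c₁ ∧ 0 < c₂ ∧
      ∀ (n₁ n₂ r : ℕ) (hr : 0 < r)
        (X : Matrix (Fin n₁) (Fin n₂) ℝ)
        (U : Matrix (Fin n₁) (Fin r) ℝ) (σ : Fin r → ℝ) (V : Matrix (Fin n₂) (Fin r) ℝ)
        (μ : ℝ) (p : unitInterval),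
        X.rank = r →
        MatrixCompletion.IsSVD X U σ V →
        MatrixCompletion.IsIncoherent μ U V →
        0 < (p : ℝ) →
        c * μ * (r : ℝ) ^ 2 * (σ ⟨0, hr⟩ / σ ⟨r - 1, Nat.sub_one_lt_of_lt hr⟩) ^ 2
            * Real.log (max n₁ n₂ : ℕ) / (min n₁ n₂ : ℕ) ≤ (p : ℝ) →
        1 - c₁ * ((max n₁ n₂ : ℕ) : ℝ) ^ (-c₂) ≤
          (ProbabilityTheory.setBernoulli (Set.univ : Set (Fin n₁ × Fin n₂)) p).real
            {Ω | ∀ (U₀ : Matrix (Fin n₁) (Fin r) ℝ) (σ₀ : Fin r → ℝ)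
                (V₀ : Matrix (Fin n₂) (Fin r) ℝ)
                (Zs Z₀ Z₁ : Matrix (Fin n₁ ⊕ Fin n₂) (Fin r) ℝ),
                MatrixCompletion.IsTruncatedSVD
                  ((p : ℝ)⁻¹ • MatrixCompletion.sampleProj Ω X) U₀ σ₀ V₀ →
                Zs = MatrixCompletion.liftedFactor U σ V →
                Z₀ = MatrixCompletion.liftedFactor U₀ σ₀ V₀ →
                Z₁ = MatrixCompletion.clipRows (MatrixCompletion.clipRadius μ Z₀) Z₀ →
                MatrixCompletion.factorDist Z₁ Zs ≤ MatrixCompletion.factorDist Z₀ Zs ∧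
                MatrixCompletion.factorDist Z₀ Zs ≤
                  1 / 4 * Real.sqrt (σ ⟨r - 1, Nat.sub_one_lt_of_lt hr⟩)} := by
  refine ⟨7200, 2, 1, by norm_num, by norm_num, by norm_num, ?_⟩
  intro n₁ n₂ r hr X U σ V μ p hrank hX hinc hp hpc
  set P := ProbabilityTheory.setBernoulli (Set.univ : Set (Fin n₁ × Fin n₂)) p
  -- For `n = 1` the logarithm vanishes and the sampling hypothesis is empty, but the claimed
  -- probability bound `1 - 2` is negative.
  rcases le_or_gt (max n₁ n₂) 1 with hn | hn
  · have h1 := X.rank_le_width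
    have hn1 : max n₁ n₂ = 1 := by omega
    rw [hn1, Nat.cast_one, Real.one_rpow]
    exact le_trans (by norm_num) measureReal_nonneg
  have hbad := MatrixCompletion.setBernoulli_real_sampling_le hr hX hrank hinc p hp hn hpc
  set bad := {Ω | ¬ ∀ u v, 2 * (u ⬝ᵥ ((p : ℝ)⁻¹ • MatrixCompletion.sampleProj Ω X - X).mulVec v) ≤
        σ ⟨r - 1, Nat.sub_one_lt_of_lt hr⟩ / (20 * Real.sqrt r) * (u ⬝ᵥ u + v ⬝ᵥ v)} with hbad_def
  set good := {Ω | ∀ (U₀ : Matrix (Fin n₁) (Fin r) ℝ) (σ₀ : Fin r → ℝ)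
                (V₀ : Matrix (Fin n₂) (Fin r) ℝ)
                (Zs Z₀ Z₁ : Matrix (Fin n₁ ⊕ Fin n₂) (Fin r) ℝ),
                MatrixCompletion.IsTruncatedSVD
                  ((p : ℝ)⁻¹ • MatrixCompletion.sampleProj Ω X) U₀ σ₀ V₀ →
                Zs = MatrixCompletion.liftedFactor U σ V →
                Z₀ = MatrixCompletion.liftedFactor U₀ σ₀ V₀ →
                Z₁ = MatrixCompletion.clipRows (MatrixCompletion.clipRadius μ Z₀) Z₀ →
                MatrixCompletion.factorDist Z₁ Zs ≤ MatrixCompletion.factorDist Z₀ Zs ∧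
                MatrixCompletion.factorDist Z₀ Zs ≤
                  1 / 4 * Real.sqrt (σ ⟨r - 1, Nat.sub_one_lt_of_lt hr⟩)} with hgood_def
  -- Covering the space and using subadditivity avoids any measurability question about `good`,
  -- which quantifies over all truncated SVDs.
  have hcover : bad ∪ good = Set.univ := by
    refine Set.eq_univ_of_forall fun Ω => ?_
    by_cases hΩ : Ω ∈ bad
    · exact Or.inl hΩ
    · right
      rw [hbad_def, Set.mem_ofPred_eq, not_not] at hΩ
      rintro U₀ σ₀ V₀ _ _ _ h₀ rfl rfl rfl
      have ha0 := hX.sigma_last_pos hrank hr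
      have hr0 : (0 : ℝ) < r := by exact_mod_cast hr
      have hs : 0 < σ ⟨r - 1, Nat.sub_one_lt_of_lt hr⟩ / (20 * Real.sqrt r) := by positivity
      refine MatrixCompletion.factorDist_liftedFactor_le hr hX hrank hinc h₀ hs.le (le_of_eq ?_)
        (MatrixCompletion.mulVec_dotProduct_le_of_bilinear _ hs hΩ)
      rw [div_pow, mul_pow, Real.sq_sqrt hr0.le]
      field_simp
      norm_num
  have h1 : 1 ≤ P.real bad + P.real good := by
    have := measureReal_union_le (μ := P) bad good
    rwa [hcover, probReal_univ] at this
  linarith
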